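/- Let $\ell$ be a prime and let $\varepsilon>0$. There is a constant $C=C(\ell,\varepsilon)>0$ such that for every pure cubic field $K$, that is, every number field $K=\mathbb{Q}(\sqrt[3]{d})$ with $d>1$ a cube-free integer, one has \[ h_\ell(K)\le C\,|\Delta_K|^{\frac12-\frac1{4\ell}+\varepsilon}, \] where $\Delta_K$ is the discriminant of $K$ and $h_\ell(K)$ is the order of the $\ell$-torsion subgroup $\{c\in\mathrm{Cl}(K): c^\ell=1\}$ of the class group $\mathrm{Cl}(K)$ of $K$. -/

import Mathlib

open NumberField

/-- A pure cubic field: `K = ℚ(∛d)` for a cube-free integer `d > 1`. -/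
def IsPureCubicField (K : Type*) [Field K] [NumberField K] : Prop :=
  ∃ d : ℕ, 1 < d ∧ (∀ m : ℕ, m ^ 3 ∣ d → m = 1) ∧
    ∃ α : K, α ^ 3 = (d : K) ∧ IntermediateField.adjoin ℚ {α} = ⊤

/-- The `ℓ`-torsion subgroup of the class group of `K`: the ideal classes `c` with `c ^ ℓ = 1`. -/
noncomputable def classGroupTorsion (ℓ : ℕ) (K : Type*) [Field K] [NumberField K] :
    Subgroup (ClassGroup (𝓞 K)) :=
  (powMonoidHom ℓ : ClassGroup (𝓞 K) →* ClassGroup (𝓞 K)).ker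

/-- `h_ℓ(K)`, the order of the `ℓ`-torsion subgroup of the class group of `K`. -/
noncomputable def torsionClassNumber (ℓ : ℕ) (K : Type*) [Field K] [NumberField K] : ℕ :=
  Nat.card (classGroupTorsion ℓ K)

/-!
# The `ℓ`-torsion in the class groups of pure cubic fields

The proof follows the principle of Ellenberg and Venkatesh: many prime ideals of small norm force
the `ℓ`-torsion of the class group to be small. Let `K` be a cubic field, `D = |Δ_K|`, and let
`P_p` be ideals of prime norm `p`, for `p` in a finite set `T`.

* To an `ℓ`-torsion class `c`, represented by an ideal `I` with `I ^ ℓ = (α)`, and to `p ∈ T`,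
  Minkowski's theorem attaches an element `γ` of `I P_p` and the ideal `B` with `(γ) = I P_p B`.
  The infinite places are weighted by `|α| ^ (1 / ℓ)`; this takes the place of the regulator, as the
  weights make the class of `I` torsion also at infinity. Then `B` has norm at most `9 √D`, and the
  normalised sizes of `γ` at the infinite places lie in a box of logarithmic size
  (`exists_span_eq_mul_mul`).
* Suppose that two pairs with different primes `p`, `q` give the same `B` and nearly the same sizes.
  Then `P_q ^ ℓ / P_p ^ ℓ` has a generator `δ` whose absolute values are all about
  `(q / p) ^ (ℓ / 3)`. If `p` does not divide `Δ_K`, then `δ` is irrational, so `1, δ, δ ^ 2` are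
  independent elements of `P_p ^ (-2ℓ)`. Comparing their discriminant with that of the fractional
  ideal shows that `D` is at most a constant times `(p q) ^ (2ℓ)`
  (`abs_discr_le_of_span_mul_pow_eq`, `abs_discr_le_of_collision`).
* So if all `p ∈ T` are below a small multiple of `D ^ (1 / (4ℓ))`, the map from pairs to ideals and
  boxes is injective, and `h_ℓ(K) · #T` is at most `√D` up to logarithms
  (`torsionClassNumber_mul_card_le`). The number of ideals of norm at most `N` is bounded uniformly
  in `K` by the number of triples with product at most `N` (`ncard_ideals_norm_le`).

What is special about pure cubic fields is that the primes needed exist unconditionally: modulo a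
prime `p ≡ 2 mod 3` every residue class has exactly one cube root, which yields an ideal of norm `p`
(`IsPureCubicField.exists_absNorm_eq`). That there are at least `N ^ (1 - δ)` such primes up to
large `N` is an elementary estimate in the manner of Chebyshev
(`eventually_le_card_primesTwoModThree`).
-/

/-! ### Primes congruent to `2` modulo `3` -/

section PrimesModThree

open Finset ArithmeticFunction Filter

/-- The non-trivial Dirichlet character modulo `3`, as a real-valued arithmetic function. -/
noncomputable def chiThree : ArithmeticFunction ℝ where
  toFun n := if n % 3 = 1 then 1 else if n % 3 = 2 then -1 else 0
  map_zero' := by simp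

lemma chiThree_apply (n : ℕ) :
    chiThree n = if n % 3 = 1 then 1 else if n % 3 = 2 then -1 else 0 := rfl

lemma chiThree_mul (m n : ℕ) : chiThree (m * n) = chiThree m * chiThree n := by
  simp only [chiThree_apply, Nat.mul_mod m n 3]
  have hm : m % 3 < 3 := Nat.mod_lt _ (by norm_num)
  have hn : n % 3 < 3 := Nat.mod_lt _ (by norm_num)
  generalize m % 3 = a at *
  generalize n % 3 = b at *
  interval_cases a <;> interval_cases b <;> norm_num

lemma sum_chiThree (N : ℕ) : ∑ m ∈ Ioc 0 N, chiThree m = if N % 3 = 1 then 1 else 0 := by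
  induction N with
  | zero => simp
  | succ n ih =>
    rw [sum_Ioc_succ_top (Nat.zero_le n), ih, chiThree_apply]
    have : n % 3 = 0 ∨ n % 3 = 1 ∨ n % 3 = 2 := by omega
    rcases this with h | h | h
    · simp [h, Nat.add_mod]
    · simp [h, Nat.add_mod]
    · simp [h, Nat.add_mod]

/-- Only an upper bound is needed: the terms at `3 k + 1` and `3 k + 2` add up to at most `0`. -/
lemma sum_chiThree_mul_log_le (N : ℕ) :
    ∑ m ∈ Ioc 0 N, chiThree m * Real.log m ≤ Real.log (N + 1) := by
  have c0 (k : ℕ) : chiThree (3 * k + 1 + 1 + 1) = 0 := by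
    rw [chiThree_apply, if_neg (by omega), if_neg (by omega)]
  have c1 (k : ℕ) : chiThree (3 * k + 1) = 1 := by rw [chiThree_apply, if_pos (by omega)]
  have c2 (k : ℕ) : chiThree (3 * k + 1 + 1) = -1 := by
    rw [chiThree_apply, if_neg (by omega), if_pos (by omega)]
  have mono (k : ℕ) : Real.log ((3 * k + 1 : ℕ) : ℝ) ≤ Real.log ((3 * k + 1 + 1 : ℕ) : ℝ) :=
    Real.log_le_log (by positivity) (by push_cast; linarith)
  have key (k : ℕ) : ∑ m ∈ Ioc 0 (3 * k), chiThree m * Real.log m ≤ 0 := by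
    induction k with
    | zero => simp
    | succ k ih =>
      rw [show 3 * (k + 1) = 3 * k + 1 + 1 + 1 by ring, sum_Ioc_succ_top (Nat.zero_le _),
        sum_Ioc_succ_top (Nat.zero_le _), sum_Ioc_succ_top (Nat.zero_le _), c0, c1, c2]
      linarith [mono k]
  have hlog : 0 ≤ Real.log ((N : ℝ) + 1) := Real.log_nonneg (by linarith [N.cast_nonneg (α := ℝ)])
  obtain ⟨k, hk | hk | hk⟩ : ∃ k, N = 3 * k ∨ N = 3 * k + 1 ∨ N = 3 * k + 1 + 1 :=
    ⟨N / 3, by omega⟩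
  · exact (hk ▸ key k).trans hlog
  · have h : Real.log (N : ℝ) ≤ Real.log ((N : ℝ) + 1) :=
      Real.log_le_log (by rw [hk]; positivity) (by linarith)
    subst hk
    rw [sum_Ioc_succ_top (Nat.zero_le _), c1]
    linarith [key k]
  · subst hk
    rw [sum_Ioc_succ_top (Nat.zero_le _), sum_Ioc_succ_top (Nat.zero_le _), c1, c2]
    linarith [mono k, key k]

/-- Opening `log = Λ * 1` under the character `χ`: the inner partial sums of `χ` are `0` or `1`. -/
lemma sum_chiThree_mul_log (N : ℕ) :
    ∑ m ∈ Ioc 0 N, chiThree m * Real.log m =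
      ∑ d ∈ Ioc 0 N, chiThree d * Λ d * (if N / d % 3 = 1 then 1 else 0) := by
  have h := sum_Ioc_mul_eq_sum_sum (chiThree.pmul Λ) chiThree N
  have h2 : (chiThree.pmul Λ) * chiThree = chiThree.pmul ArithmeticFunction.log := by
    ext n
    rw [mul_apply, pmul_apply, log_apply, ← vonMangoldt_sum,
      ← Nat.sum_divisorsAntidiagonal (fun i _ ↦ Λ i), mul_sum]
    refine sum_congr rfl fun x hx ↦ ?_
    obtain ⟨hx, -⟩ := Nat.mem_divisorsAntidiagonal.mp hx
    rw [← hx, chiThree_mul, pmul_apply]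
    ring
  rw [h2] at h
  simpa [sum_chiThree] using h

/-- The number of primes `p ≤ N` with `p ≡ 2 mod 3`. -/
def primesTwoModThree (N : ℕ) : Finset ℕ := {p ∈ Ioc 0 N | p.Prime ∧ p % 3 = 2}

/-- Since `∑ χ(m) log m` is small, prime powers in the class of `2` carry at least half of the
weight of all the primes, in the ranges which the inner sums select. -/
lemma sum_filter_prime_le (N : ℕ) :
    ∑ p ∈ Ioc 0 N with p.Prime ∧ p ≠ 3, Real.log p * (if N / p % 3 = 1 then 1 else 0) ≤
      2 * (∑ d ∈ Ioc 0 N with d % 3 = 2, Λ d * (if N / d % 3 = 1 then 1 else 0)) +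
        Real.log (N + 1) := by
  have h1 := sum_chiThree_mul_log_le N
  rw [sum_chiThree_mul_log] at h1
  refine le_trans ?_ (add_le_add_right h1 _)
  rw [mul_sum, sum_filter, sum_filter, ← sum_add_distrib]
  refine sum_le_sum fun d hd ↦ ?_
  have hΛ : 0 ≤ Λ d := vonMangoldt_nonneg
  set w : ℝ := if N / d % 3 = 1 then 1 else 0 with hw
  have hw0 : 0 ≤ w := by rw [hw]; split_ifs <;> norm_num
  have hΛw := mul_nonneg hΛ hw0
  by_cases hp : d.Prime ∧ d ≠ 3
  · rw [if_pos hp, ← vonMangoldt_apply_prime hp.1, chiThree_apply]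
    have : d % 3 ≠ 0 := fun h ↦
      hp.2 ((Nat.prime_dvd_prime_iff_eq Nat.prime_three hp.1).mp (Nat.dvd_of_mod_eq_zero h)).symm
    have : d % 3 = 1 ∨ d % 3 = 2 := by omega
    rcases this with h | h
    · simp [h]
    · simp only [h]; norm_num; linarith
  · rw [if_neg hp, chiThree_apply]
    have : d % 3 = 0 ∨ d % 3 = 1 ∨ d % 3 = 2 := by omega
    rcases this with h | h | h
    · simp [h]
    · simp [h]; linarith
    · simp only [h]; norm_num; linarith

/-- The weights of `sum_filter_prime_le` at `N` and at `N / 2` together cover `(N / 4, N]`. -/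
lemma theta_sub_theta_le (N : ℕ) :
    Chebyshev.theta N - Chebyshev.theta (N / 4 : ℕ) ≤
      4 * (∑ d ∈ Ioc 0 N with d % 3 = 2, Λ d) + 2 * Real.log (N + 1) + Real.log 3 := by
  have h1 := sum_filter_prime_le N
  have h2 := sum_filter_prime_le (N / 2)
  have hlog : Real.log ((N / 2 : ℕ) + 1) ≤ Real.log (N + 1) := by
    apply Real.log_le_log (by positivity)
    have : ((N / 2 : ℕ) : ℝ) ≤ N := by exact_mod_cast Nat.div_le_self N 2
    linarith
  have hext : ∀ (f : ℕ → ℝ) (q : ℕ → Prop) [DecidablePred q],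
      ∑ d ∈ Ioc 0 (N / 2) with q d, f d * (if N / 2 / d % 3 = 1 then 1 else 0) =
      ∑ d ∈ Ioc 0 N with q d, f d * (if N / 2 / d % 3 = 1 then 1 else 0) := by
    intro f q _
    apply sum_subset
    · apply filter_subset_filter
      exact Ioc_subset_Ioc_right (Nat.div_le_self _ _)
    · intro x hx hx'
      simp only [mem_filter, mem_Ioc] at hx hx'
      rw [Nat.div_eq_of_lt (by by_contra! h; exact hx' ⟨⟨hx.1.1, h⟩, hx.2⟩)]
      simp
  rw [hext, hext] at h2
  have hA : ∑ d ∈ Ioc 0 N with d % 3 = 2, Λ d * (if N / d % 3 = 1 then 1 else 0) ≤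
      ∑ d ∈ Ioc 0 N with d % 3 = 2, Λ d := by
    refine sum_le_sum fun d _ ↦ ?_
    split_ifs
    · simp
    · simp [vonMangoldt_nonneg]
  have hB : ∑ d ∈ Ioc 0 N with d % 3 = 2, Λ d * (if N / 2 / d % 3 = 1 then 1 else 0) ≤
      ∑ d ∈ Ioc 0 N with d % 3 = 2, Λ d := by
    refine sum_le_sum fun d _ ↦ ?_
    split_ifs
    · simp
    · simp [vonMangoldt_nonneg]
  have hC : Chebyshev.theta N - Chebyshev.theta (N / 4 : ℕ) - Real.log 3 ≤
      ∑ p ∈ Ioc 0 N with p.Prime ∧ p ≠ 3, Real.log p * (if N / p % 3 = 1 then 1 else 0) +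
      ∑ p ∈ Ioc 0 N with p.Prime ∧ p ≠ 3, Real.log p * (if N / 2 / p % 3 = 1 then 1 else 0) := by
    have h4 : Chebyshev.theta (N / 4 : ℕ) = ∑ p ∈ Ioc 0 N,
        if p.Prime ∧ p ≤ N / 4 then Real.log p else 0 := by
      rw [Chebyshev.theta, Nat.floor_natCast, ← sum_filter]
      refine sum_congr ?_ fun _ _ ↦ rfl
      ext p
      simp only [mem_filter, mem_Ioc]
      have := Nat.div_le_self N 4
      constructor
      · rintro ⟨⟨h1, h2⟩, h3⟩; exact ⟨⟨h1, by omega⟩, h3, h2⟩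
      · rintro ⟨⟨h1, h2⟩, h3, h4⟩; exact ⟨⟨h1, h4⟩, h3⟩
    have h3 : ∑ p ∈ Ioc 0 N, (if p = 3 then Real.log 3 else 0) ≤ Real.log 3 := by
      rw [sum_ite_eq']
      split_ifs
      · rfl
      · positivity
    rw [← sum_add_distrib]
    refine le_trans (sub_le_sub_left h3 _) ?_
    rw [h4, Chebyshev.theta, Nat.floor_natCast, sum_filter, sum_filter, ← sum_sub_distrib,
      ← sum_sub_distrib]
    refine sum_le_sum fun p hp ↦ ?_
    have hp0 := (mem_Ioc.mp hp).1
    have hpN := (mem_Ioc.mp hp).2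
    have hlogp : 0 ≤ Real.log p := Real.log_natCast_nonneg p
    by_cases hpp : p.Prime
    · by_cases hp3 : p = 3
      · subst hp3
        by_cases h : 3 ≤ N / 4
        · simp only [hpp, h]; norm_num; positivity
        · simp [hpp, h]
      · simp only [hpp, hp3, true_and, ne_eq, not_false_eq_true, and_self, if_true, if_false]
        by_cases h : p ≤ N / 4
        · simp only [h, if_true]
          split_ifs <;> simp <;> linarith
        · simp only [h, if_false]
          have hk1 : 1 ≤ N / p := (Nat.one_le_div_iff hp0).mpr hpN
          have hk2 : N / p < 4 := by
            rw [Nat.div_lt_iff_lt_mul hp0]; omega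
          -- For `k = N / p ∈ {1, 2, 3}`, one of `k` and `k / 2` is `1` modulo `3`.
          rw [Nat.div_div_eq_div_mul, mul_comm 2 p, ← Nat.div_div_eq_div_mul]
          generalize N / p = k at *
          interval_cases k <;> simp
    · by_cases hp3 : p = 3
      · exact absurd (hp3 ▸ Nat.prime_three) hpp
      · simp [hpp, hp3]
  linarith

/-- An explicit Chebyshev lower bound for the number of primes congruent to `2` modulo `3`. -/
lemma le_card_primesTwoModThree {N : ℕ} (hN : 1 ≤ N) :
    Real.log 2 / 2 * N - 3 * Real.log (N + 1) - 10 * (√N * Real.log N) - Real.log 3 ≤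
      4 * (#(primesTwoModThree N) * Real.log N) := by
  have h1 := theta_sub_theta_le N
  have h2 := Chebyshev.theta_ge N
  have h3 : Chebyshev.theta (N / 4 : ℕ) ≤ Real.log 2 / 2 * N := by
    refine (Chebyshev.theta_le_log4_mul_x (Nat.cast_nonneg _)).trans ?_
    have h4 : Real.log 4 = 2 * Real.log 2 := by
      rw [show (4 : ℝ) = 2 ^ 2 by norm_num, Real.log_pow]; norm_num
    have h5 : ((N / 4 : ℕ) : ℝ) ≤ N / 4 := Nat.cast_div_le
    have : 0 < Real.log 2 := Real.log_pos (by norm_num)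
    rw [h4]
    nlinarith
  have h4 : ∑ d ∈ Ioc 0 N with d % 3 = 2, Λ d ≤
      #(primesTwoModThree N) * Real.log N + 2 * √N * Real.log N := by
    have h5 := Chebyshev.psi_sub_theta_le (x := N) (by exact_mod_cast hN)
    rw [Chebyshev.psi_sub_theta_eq_sum_not_prime, Nat.floor_natCast] at h5
    rw [← sum_filter_add_sum_filter_not _ Nat.Prime]
    refine add_le_add ?_ (le_trans ?_ h5)
    · rw [← nsmul_eq_mul, filter_filter]
      simp only [and_comm (b := Nat.Prime _)]
      refine sum_le_card_nsmul _ _ _ fun p hp ↦ ?_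
      simp only [mem_filter, mem_Ioc] at hp
      refine vonMangoldt_le_log.trans (Real.log_le_log ?_ ?_)
      · exact_mod_cast hp.1.1
      · exact_mod_cast hp.1.2
    · rw [filter_filter]
      refine sum_le_sum_of_subset_of_nonneg (fun p hp ↦ ?_) fun _ _ _ ↦ vonMangoldt_nonneg
      simp only [mem_filter] at hp ⊢
      exact ⟨hp.1, hp.2.2⟩
  linarith

lemma eventually_le_card_primesTwoModThree {δ : ℝ} (hδ : 0 < δ) :
    ∀ᶠ N : ℕ in atTop, (N : ℝ) ^ (1 - δ) ≤ #(primesTwoModThree N) := by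
  have ev : ∀ᶠ x : ℝ in atTop, 4 * (x ^ (1 - δ) * Real.log x) ≤
      Real.log 2 / 2 * x - 3 * Real.log (x + 1) - 10 * (√x * Real.log x) - Real.log 3 := by
    have l2 : 0 < Real.log 2 := Real.log_pos (by norm_num)
    -- Each error term is at most a small multiple of `c x`; `50` leaves room for their total.
    set c := Real.log 2 / 50 with hc
    have hc0 : 0 < c := by positivity
    have e1 := (isLittleO_log_rpow_atTop hδ).bound hc0
    have e2 := (isLittleO_log_rpow_atTop (show (0 : ℝ) < 1 / 2 by norm_num)).bound
      (show 0 < c / 10 by positivity)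
    have e3 := (isLittleO_log_rpow_atTop (show (0 : ℝ) < 1 by norm_num)).bound hc0
    have e4 := eventually_ge_atTop (max 1 ((3 * Real.log 2 + Real.log 3) / c))
    filter_upwards [e1, e2, e3, e4] with x h1 h2 h3 h4
    have hx1 : 1 ≤ x := (le_max_left _ _).trans h4
    have hx0 : 0 < x := by linarith
    have h4 := (le_max_right _ _).trans h4
    rw [div_le_iff₀ hc0] at h4
    have hl : 0 ≤ Real.log x := Real.log_nonneg hx1
    have hlog : Real.log (x + 1) ≤ Real.log 2 + Real.log x := by
      rw [← Real.log_mul (by norm_num) hx0.ne']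
      exact Real.log_le_log (by linarith) (by linarith)
    rw [Real.norm_of_nonneg hl, Real.norm_of_nonneg (by positivity)] at h1 h2 h3
    have g1 : x ^ (1 - δ) * Real.log x ≤ c * x := by
      calc x ^ (1 - δ) * Real.log x ≤ x ^ (1 - δ) * (c * x ^ δ) := by gcongr
        _ = c * (x ^ (1 - δ) * x ^ δ) := by ring
        _ = c * x := by rw [← Real.rpow_add hx0]; simp
    have g2 : √x * Real.log x ≤ c / 10 * x := by
      calc √x * Real.log x ≤ √x * (c / 10 * x ^ (1 / 2 : ℝ)) := by gcongr
        _ = c / 10 * (√x * √x) := by rw [← Real.sqrt_eq_rpow]; ring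
        _ = c / 10 * x := by rw [Real.mul_self_sqrt hx0.le]
    rw [Real.rpow_one] at h3
    have : Real.log 2 = 50 * c := by rw [hc]; ring
    nlinarith
  filter_upwards [tendsto_natCast_atTop_atTop.eventually ev, eventually_ge_atTop 2] with N h hN
  have h' := h.trans (le_card_primesTwoModThree (by omega : 1 ≤ N))
  have hl : 0 < Real.log N := Real.log_pos (by exact_mod_cast hN)
  nlinarith

end PrimesModThree

/-! ### Counting ideals of bounded norm -/

section CountIdeals

open Ideal UniqueFactorizationMonoid

variable {K : Type*} [Field K] [NumberField K]

lemma card_primeFactors_span_natCast_le {p : ℕ} (hp : p.Prime) :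
    (normalizedFactors (span {(p : 𝓞 K)})).toFinset.card ≤ Module.finrank ℚ K := by
  have h0 : span {(p : 𝓞 K)} ≠ 0 := by
    rw [Ne, zero_eq_bot, span_singleton_eq_bot]
    exact_mod_cast hp.ne_zero
  have hdvd : ∏ P ∈ (normalizedFactors (span {(p : 𝓞 K)})).toFinset, P ∣ span {(p : 𝓞 K)} := by
    have h1 := prod_normalizedFactors_eq h0
    rw [normalize_eq] at h1
    conv_rhs => rw [← h1]
    rw [Finset.prod_eq_multiset_prod, Multiset.toFinset_val, Multiset.map_id']
    exact Multiset.prod_dvd_prod_of_le (Multiset.dedup_le _)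
  have h2 := map_dvd absNorm hdvd
  rw [absNorm_span_natCast, map_prod, RingOfIntegers.rank] at h2
  have h3 : p ^ (normalizedFactors (span {(p : 𝓞 K)})).toFinset.card ∣
      ∏ P ∈ (normalizedFactors (span {(p : 𝓞 K)})).toFinset, absNorm P := by
    rw [← Finset.prod_const]
    refine Finset.prod_dvd_prod_of_dvd _ _ fun P hP ↦ ?_
    rw [Multiset.mem_toFinset] at hP
    have hN : absNorm P ∣ p ^ Module.finrank ℤ (𝓞 K) := by
      rw [← absNorm_span_natCast]
      exact map_dvd absNorm (dvd_of_mem_normalizedFactors hP)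
    obtain ⟨k, -, hk⟩ := (Nat.dvd_prime_pow hp).mp hN
    rw [hk]
    refine dvd_pow_self p fun hk0 ↦ ?_
    rw [hk0, pow_zero, absNorm_eq_one_iff] at hk
    exact (isPrime_of_prime (prime_of_normalized_factor _ hP)).ne_top hk
  exact (Nat.pow_dvd_pow_iff_le_right hp.one_lt).mp (h3.trans h2)

/-- In a cubic field the primes can be numbered by `Fin 3` so that primes above the same rational
prime have different numbers. -/
lemma exists_numbering_of_primes (hK : Module.finrank ℚ K = 3) :
    ∃ c : Ideal (𝓞 K) → Fin 3, ∀ P Q : Ideal (𝓞 K), Prime P → Prime Q →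
      ∀ p : ℕ, p.Prime → p ∣ absNorm P → p ∣ absNorm Q → c P = c Q → P = Q := by
  classical
  have hp (p : ℕ) : ∃ f : Ideal (𝓞 K) → Fin 3, p.Prime →
      Set.InjOn f (normalizedFactors (span {(p : 𝓞 K)})).toFinset := by
    by_cases hpp : p.Prime
    · have hc := card_primeFactors_span_natCast_le (K := K) hpp
      rw [hK] at hc
      refine ⟨fun P ↦ if h : P ∈ (normalizedFactors (span {(p : 𝓞 K)})).toFinset then
        Fin.castLE hc (Finset.equivFin _ ⟨P, h⟩) else 0, fun _ P hP Q hQ h ↦ ?_⟩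
      rw [Finset.mem_coe] at hP hQ
      simp only [dif_pos hP, dif_pos hQ] at h
      simpa using (Finset.equivFin _).injective (Fin.castLE_injective hc h)
    · exact ⟨fun _ ↦ 0, fun h ↦ absurd h hpp⟩
  choose f hf using hp
  have mem (P : Ideal (𝓞 K)) (hP : Prime P) (p : ℕ) (hpp : p.Prime) (hd : p ∣ absNorm P) :
      (absNorm P).minFac = p ∧ P ∈ (normalizedFactors (span {(p : 𝓞 K)})).toFinset := by
    have := isPrime_of_prime hP
    have hmax : P.IsMaximal := this.isMaximal hP.ne_zero
    obtain ⟨q, k, hk, hqP, hq, hN⟩ := exists_prime_and_absNorm_eq_pow P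
    have hpq : p = q := (Nat.prime_dvd_prime_iff_eq hpp hq).mp (hpp.dvd_of_dvd_pow (hN ▸ hd))
    subst hpq
    refine ⟨by rw [hN, hpp.pow_minFac hk.ne'], ?_⟩
    have h0 : span {(p : 𝓞 K)} ≠ 0 := by
      rw [Ne, zero_eq_bot, span_singleton_eq_bot]
      exact_mod_cast hpp.ne_zero
    rw [Multiset.mem_toFinset, mem_normalizedFactors_iff' h0]
    refine ⟨hP.irreducible, normalize_eq _, ?_⟩
    rwa [dvd_span_singleton]
  refine ⟨fun P ↦ f (absNorm P).minFac P, fun P Q hP hQ p hpp h1 h2 h ↦ ?_⟩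
  obtain ⟨e1, m1⟩ := mem P hP p hpp h1
  obtain ⟨e2, m2⟩ := mem Q hQ p hpp h2
  simp only [e1, e2] at h
  exact hf p hpp m1 m2 h


/-- The part of the norm of an ideal (given by its multiset of prime factors) that comes from the
primes with number `j`. -/
noncomputable def partialNorm (c : Ideal (𝓞 K) → Fin 3) (s : Multiset (Ideal (𝓞 K))) (j : Fin 3) :
    ℕ :=
  ((s.filter fun P ↦ c P = j).map absNorm).prod

lemma prod_partialNorm (c : Ideal (𝓞 K) → Fin 3) (s : Multiset (Ideal (𝓞 K))) :
    ∏ j, partialNorm c s j = (s.map absNorm).prod := by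
  classical
  induction s using Multiset.induction_on with
  | empty => simp [partialNorm]
  | cons P s ih =>
    have h (j : Fin 3) : partialNorm c (P ::ₘ s) j =
        (if c P = j then absNorm P else 1) * partialNorm c s j := by
      unfold partialNorm
      rw [Multiset.filter_cons]
      split_ifs <;> simp
    simp only [h, Finset.prod_mul_distrib, ih, Multiset.map_cons, Multiset.prod_cons]
    simp

lemma partialNorm_ne_zero (c : Ideal (𝓞 K) → Fin 3) {s : Multiset (Ideal (𝓞 K))}
    (hs : ∀ P ∈ s, Prime P) (j : Fin 3) : partialNorm c s j ≠ 0 := by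
  unfold partialNorm
  rw [Ne, Multiset.prod_eq_zero_iff, Multiset.mem_map]
  rintro ⟨P, hP, h0⟩
  exact (hs P (Multiset.mem_of_mem_filter hP)).ne_zero (absNorm_eq_zero_iff.mp h0)

/-- Only one prime with a given number lies above `p`, so the exponent of `p` in the partial norm
recovers the multiplicity of that prime. -/
lemma factorization_partialNorm [DecidableEq (Ideal (𝓞 K))] {c : Ideal (𝓞 K) → Fin 3}
    (hc : ∀ P Q : Ideal (𝓞 K), Prime P → Prime Q →
      ∀ p : ℕ, p.Prime → p ∣ absNorm P → p ∣ absNorm Q → c P = c Q → P = Q)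
    {P : Ideal (𝓞 K)} (hP : Prime P) {p : ℕ} (hp : p.Prime) (hpP : p ∣ absNorm P)
    {s : Multiset (Ideal (𝓞 K))} (hs : ∀ Q ∈ s, Prime Q) :
    (partialNorm c s (c P)).factorization p = s.count P * (absNorm P).factorization p := by
  induction s using Multiset.induction_on with
  | empty => simp [partialNorm]
  | cons Q s ih =>
    have hs' : ∀ R ∈ s, Prime R := fun R hR ↦ hs R (Multiset.mem_cons_of_mem hR)
    have hQ : Prime Q := hs Q (Multiset.mem_cons_self _ _)
    have h : partialNorm c (Q ::ₘ s) (c P) =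
        (if c Q = c P then absNorm Q else 1) * partialNorm c s (c P) := by
      unfold partialNorm
      rw [Multiset.filter_cons]
      split_ifs <;> simp
    have hN : absNorm Q ≠ 0 := fun h ↦ hQ.ne_zero (absNorm_eq_zero_iff.mp h)
    rw [h, Nat.factorization_mul (by split_ifs <;> simp [hN]) (partialNorm_ne_zero c hs' _),
      Finsupp.add_apply, ih hs', Multiset.count_cons]
    by_cases hPQ : P = Q
    · subst hPQ
      simp
      ring
    · rw [if_neg hPQ]
      split_ifs with hcc
      · rw [Nat.factorization_eq_zero_of_not_dvd fun hd ↦ hPQ (hc P Q hP hQ p hp hpP hd hcc.symm)]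
        simp
      · simp

lemma partialNorm_injective {c : Ideal (𝓞 K) → Fin 3}
    (hc : ∀ P Q : Ideal (𝓞 K), Prime P → Prime Q →
      ∀ p : ℕ, p.Prime → p ∣ absNorm P → p ∣ absNorm Q → c P = c Q → P = Q)
    {s t : Multiset (Ideal (𝓞 K))} (hs : ∀ P ∈ s, Prime P) (ht : ∀ P ∈ t, Prime P)
    (h : partialNorm c s = partialNorm c t) : s = t := by
  classical
  ext P
  by_cases hP : Prime P
  · have hN1 : absNorm P ≠ 1 := fun h1 ↦
      (isPrime_of_prime hP).ne_top (absNorm_eq_one_iff.mp h1)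
    have hN0 : absNorm P ≠ 0 := fun h ↦ hP.ne_zero (absNorm_eq_zero_iff.mp h)
    have hp := Nat.minFac_prime hN1
    have hd := Nat.minFac_dvd (absNorm P)
    have e1 := factorization_partialNorm hc hP hp hd hs
    rw [h, factorization_partialNorm hc hP hp hd ht] at e1
    exact (Nat.eq_of_mul_eq_mul_right (hp.factorization_pos_of_dvd hN0 hd) e1).symm
  · rw [Multiset.count_eq_zero_of_notMem fun h ↦ hP (hs P h),
      Multiset.count_eq_zero_of_notMem fun h ↦ hP (ht P h)]

lemma card_triples_prod_le (N : ℕ) :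
    ((((Finset.Icc 1 N ×ˢ Finset.Icc 1 N ×ˢ Finset.Icc 1 N).filter
      fun t ↦ t.1 * t.2.1 * t.2.2 ≤ N).card : ℕ) : ℝ) ≤ N * (1 + Real.log N) ^ 2 := by
  have h1 : ((Finset.Icc 1 N ×ˢ Finset.Icc 1 N ×ˢ Finset.Icc 1 N).filter
      fun t ↦ t.1 * t.2.1 * t.2.2 ≤ N).card ≤
      ∑ a ∈ Finset.Icc 1 N, ∑ b ∈ Finset.Icc 1 N, N / (a * b) := by
    rw [Finset.card_filter, Finset.sum_product]
    refine Finset.sum_le_sum fun a ha ↦ ?_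
    rw [Finset.sum_product]
    refine Finset.sum_le_sum fun b hb ↦ ?_
    rw [← Finset.card_filter]
    refine (Finset.card_le_card (t := Finset.Icc 1 (N / (a * b))) fun x hx ↦ ?_).trans (by simp)
    simp only [Finset.mem_filter, Finset.mem_Icc] at hx ha hb ⊢
    refine ⟨hx.1.1, (Nat.le_div_iff_mul_le (Nat.mul_pos ha.1 hb.1)).mpr ?_⟩
    rw [mul_comm]
    exact hx.2
  have h2 : (∑ a ∈ Finset.Icc 1 N, ∑ b ∈ Finset.Icc 1 N, ((N / (a * b) : ℕ) : ℝ)) ≤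
      N * (harmonic N : ℝ) ^ 2 := by
    rw [harmonic_eq_sum_Icc]
    push_cast
    rw [sq, Finset.sum_mul_sum, Finset.mul_sum]
    refine Finset.sum_le_sum fun a _ ↦ ?_
    rw [Finset.mul_sum]
    refine Finset.sum_le_sum fun b _ ↦ ?_
    refine Nat.cast_div_le.trans (le_of_eq ?_)
    push_cast
    rw [div_eq_mul_inv, mul_inv]
  have h3 : (0 : ℝ) ≤ harmonic N := by
    rw [harmonic_eq_sum_Icc]
    push_cast
    positivity
  calc _ ≤ (∑ a ∈ Finset.Icc 1 N, ∑ b ∈ Finset.Icc 1 N, ((N / (a * b) : ℕ) : ℝ)) := by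
        exact_mod_cast h1
    _ ≤ _ := h2
    _ ≤ _ := by gcongr; exact harmonic_le_one_add_log N

/-- The number of ideals of norm at most `N` in a cubic field is at most the number of triples of
positive integers with product at most `N`. -/
theorem ncard_ideals_norm_le (hK : Module.finrank ℚ K = 3) (N : ℕ) :
    (({I : Ideal (𝓞 K) | I ≠ ⊥ ∧ absNorm I ≤ N}.ncard : ℕ) : ℝ) ≤ N * (1 + Real.log N) ^ 2 := by
  obtain ⟨c, hc⟩ := exists_numbering_of_primes hK
  refine le_trans ?_ (card_triples_prod_le N)
  rw [← Set.ncard_coe_finset]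
  have hpr (I : Ideal (𝓞 K)) : ∀ P ∈ normalizedFactors I, Prime P :=
    fun P hP ↦ prime_of_normalized_factor P hP
  refine Nat.cast_le.mpr <| Set.ncard_le_ncard_of_injOn
    (fun I ↦ (partialNorm c (normalizedFactors I) 0, partialNorm c (normalizedFactors I) 1,
      partialNorm c (normalizedFactors I) 2)) ?_ ?_ (Finset.finite_toSet _)
  · rintro I ⟨hI, hIN⟩
    have h1 := prod_partialNorm c (normalizedFactors I)
    rw [← map_multiset_prod, prod_normalizedFactors_eq hI, normalize_eq, Fin.prod_univ_three] at h1
    have h2 (j : Fin 3) : 1 ≤ partialNorm c (normalizedFactors I) j :=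
      Nat.one_le_iff_ne_zero.mpr (partialNorm_ne_zero c (hpr I) j)
    have h0 := h2 0
    have h3 := h2 1
    have h4 := h2 2
    rw [← h1] at hIN
    simp only [Finset.coe_filter, Finset.mem_product, Finset.mem_Icc, Set.mem_ofPred_eq]
    refine ⟨⟨⟨h0, ?_⟩, ⟨h3, ?_⟩, h4, ?_⟩, hIN⟩
    · exact ((Nat.le_mul_of_pos_right _ h3).trans (Nat.le_mul_of_pos_right _ h4)).trans hIN
    · exact ((Nat.le_mul_of_pos_left _ h0).trans (Nat.le_mul_of_pos_right _ h4)).trans hIN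
    · exact (Nat.le_mul_of_pos_left _ (Nat.mul_pos h0 h3)).trans hIN
  · rintro I ⟨hI, -⟩ J ⟨hJ, -⟩ h
    simp only [Prod.mk.injEq] at h
    have h' : partialNorm c (normalizedFactors I) = partialNorm c (normalizedFactors J) := by
      funext j
      fin_cases j
      exacts [h.1, h.2.1, h.2.2]
    have := congrArg Multiset.prod (partialNorm_injective hc (hpr I) (hpr J) h')
    rwa [prod_normalizedFactors_eq hI, prod_normalizedFactors_eq hJ, normalize_eq,
      normalize_eq] at this

end CountIdeals

/-! ### Primes of degree one in pure cubic fields -/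

section PureCubic

open Polynomial

lemma injective_pow_three_of_card_mod_three {F : Type*} [Field F] [Finite F]
    (hF : Nat.card F % 3 = 2) : Function.Injective fun x : F ↦ x ^ 3 := by
  have hc : (Nat.card Fˣ).Coprime 3 := by
    rw [Nat.card_units, Nat.coprime_comm, Nat.Prime.coprime_iff_not_dvd Nat.prime_three]
    omega
  intro x y hxy
  simp only at hxy
  by_cases hx : x = 0
  · rw [hx, zero_pow three_ne_zero] at hxy
    rw [hx, pow_eq_zero_iff three_ne_zero |>.mp hxy.symm]
  · have hy : y ≠ 0 := by
      rintro rfl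
      rw [zero_pow three_ne_zero] at hxy
      exact hx (pow_eq_zero_iff three_ne_zero |>.mp hxy)
    have : Units.mk0 x hx = Units.mk0 y hy := by
      apply (powCoprime hc).injective
      ext
      simpa using hxy
    simpa using congrArg Units.val this

variable {K : Type*} [Field K] [NumberField K]

lemma minpoly_eq_X_pow_three_sub_C {d : ℕ} (hd : 1 < d) (hcf : ∀ m : ℕ, m ^ 3 ∣ d → m = 1)
    {α : K} (hα : α ^ 3 = (d : K)) : minpoly ℚ α = X ^ 3 - C (d : ℚ) := by
  symm
  apply minpoly.eq_of_irreducible_of_monic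
  · refine X_pow_sub_C_irreducible_of_prime Nat.prime_three fun b hb ↦ ?_
    have hbi : IsIntegral ℤ b := by
      refine IsIntegral.of_pow (n := 3) (by norm_num) ?_
      rw [hb]
      exact_mod_cast isIntegral_algebraMap (R := ℤ) (A := ℚ) (x := (d : ℤ))
    obtain ⟨z, rfl⟩ := IsIntegrallyClosed.isIntegral_iff.mp hbi
    simp only [algebraMap_int_eq, eq_intCast] at hb
    have hz : z ^ 3 = (d : ℤ) := by exact_mod_cast hb
    have hz' : z.natAbs ^ 3 = d := by rw [← Int.natAbs_pow, hz, Int.natAbs_natCast]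
    have h1 := hcf z.natAbs (by rw [hz'])
    rw [h1] at hz'
    omega
  · simp [hα]
  · exact monic_X_pow_sub_C _ three_ne_zero

lemma IsPureCubicField.finrank_eq_three (hK : IsPureCubicField K) : Module.finrank ℚ K = 3 := by
  obtain ⟨d, hd, hcf, α, hα, htop⟩ := hK
  rw [← IntermediateField.finrank_top', ← htop, IntermediateField.adjoin.finrank
    (Algebra.IsIntegral.isIntegral α), minpoly_eq_X_pow_three_sub_C hd hcf hα, natDegree_X_pow_sub_C]

lemma trace_eq_zero_of_pow_three_eq {d : ℕ} (hd : 1 < d) (hcf : ∀ m : ℕ, m ^ 3 ∣ d → m = 1)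
    {α : K} (hα : α ^ 3 = (d : K)) : Algebra.trace ℚ K α = 0 := by
  rw [trace_eq_finrank_mul_minpoly_nextCoeff, minpoly_eq_X_pow_three_sub_C hd hcf hα,
    nextCoeff_of_natDegree_pos (by rw [natDegree_X_pow_sub_C]; norm_num), natDegree_X_pow_sub_C]
  simp [coeff_X_pow]

/-- A prime `p ≡ 2 mod 3` is not inert in a pure cubic field. Otherwise `α = ∛d` would be congruent
modulo `p` to a rational integer `n`, cube roots being unique in the residue field; taking the
trace gives `p ∣ n`, hence `p ∣ α` and `p ^ 3 ∣ d`. -/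
lemma IsPureCubicField.not_isPrime_span (hK : IsPureCubicField K) {p : ℕ} (hp : p.Prime)
    (hp3 : p % 3 = 2) : ¬ (Ideal.span {(p : 𝓞 K)}).IsPrime := by
  intro hprime
  have hfin := hK.finrank_eq_three
  obtain ⟨d, hd, hcf, α, hα, -⟩ := hK
  have hp0 : (p : 𝓞 K) ≠ 0 := by exact_mod_cast hp.ne_zero
  have hbot : Ideal.span {(p : 𝓞 K)} ≠ ⊥ := by rwa [Ne, Ideal.span_singleton_eq_bot]
  have hmax := hprime.isMaximal hbot
  let := Ideal.Quotient.field (Ideal.span {(p : 𝓞 K)})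
  have hcard : Nat.card (𝓞 K ⧸ Ideal.span {(p : 𝓞 K)}) = p ^ 3 := by
    rw [← Submodule.cardQuot_apply, ← Ideal.absNorm_apply, Ideal.absNorm_span_natCast,
      RingOfIntegers.rank, hfin]
  have : Finite (𝓞 K ⧸ Ideal.span {(p : 𝓞 K)}) :=
    Nat.finite_of_card_ne_zero (by rw [hcard]; exact pow_ne_zero _ hp.ne_zero)
  have hαi : IsIntegral ℤ α := by
    refine IsIntegral.of_pow (n := 3) (by norm_num) ?_
    rw [hα]
    exact_mod_cast isIntegral_algebraMap (R := ℤ) (A := K) (x := (d : ℤ))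
  obtain ⟨a, rfl⟩ : ∃ a : 𝓞 K, (a : K) = α := ⟨⟨α, hαi⟩, rfl⟩
  have ha : a ^ 3 = (d : 𝓞 K) := by
    apply RingOfIntegers.ext
    push_cast
    exact hα
  have : Fact p.Prime := ⟨hp⟩
  obtain ⟨n, hn⟩ : ∃ n : ℕ, (p : ℤ) ∣ (d : ℤ) - (n : ℤ) ^ 3 := by
    have hinj := injective_pow_three_of_card_mod_three (F := ZMod p) (by simpa using hp3)
    obtain ⟨y, hy⟩ := (Finite.injective_iff_surjective.mp hinj) (d : ZMod p)
    refine ⟨y.val, ?_⟩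
    rw [← ZMod.intCast_zmod_eq_zero_iff_dvd]
    simpa [sub_eq_zero] using hy.symm
  have hmem : a - n ∈ Ideal.span {(p : 𝓞 K)} := by
    rw [← Ideal.Quotient.eq]
    apply injective_pow_three_of_card_mod_three (by rw [hcard, Nat.pow_mod, hp3])
    simp only
    rw [← map_pow, ← map_pow, ha, Ideal.Quotient.eq, Ideal.mem_span_singleton]
    simpa using map_dvd (Int.castRingHom (𝓞 K)) hn
  obtain ⟨b, hb⟩ := Ideal.mem_span_singleton.mp hmem
  have hpn : p ∣ n := by
    have h1 : Algebra.trace ℤ (𝓞 K) a = 0 := by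
      have := trace_eq_zero_of_pow_three_eq hd hcf hα
      rw [← Algebra.coe_trace_int] at this
      exact_mod_cast this
    have h2 : a = algebraMap ℤ (𝓞 K) n + (p : ℤ) • b := by
      rw [zsmul_eq_mul]
      push_cast
      linear_combination hb
    rw [h2, map_add, Algebra.trace_algebraMap, map_zsmul, RingOfIntegers.rank, hfin] at h1
    have h3 : (p : ℤ) ∣ 3 * n := ⟨-Algebra.trace ℤ (𝓞 K) b, by
      simp only [smul_eq_mul, nsmul_eq_mul] at h1
      push_cast at h1
      linarith⟩
    have h4 : p ∣ 3 * n := by exact_mod_cast h3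
    refine (hp.dvd_mul.mp h4).resolve_left fun h ↦ ?_
    rw [Nat.prime_dvd_prime_iff_eq hp Nat.prime_three] at h
    rw [h] at hp3
    norm_num at hp3
  obtain ⟨m, rfl⟩ := hpn
  have hac : a = algebraMap ℤ (𝓞 K) p * (m + b) := by
    push_cast at hb ⊢
    linear_combination hb
  have hnorm := congrArg (Algebra.norm ℤ) ha
  rw [hac, map_pow, map_mul, Algebra.norm_algebraMap, RingOfIntegers.rank, hfin,
    show (d : 𝓞 K) = algebraMap ℤ (𝓞 K) d by simp, Algebra.norm_algebraMap, RingOfIntegers.rank,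
    hfin] at hnorm
  have hdvd : (p : ℤ) ^ 3 ∣ d :=
    (Int.pow_dvd_pow_iff three_ne_zero).mp (hnorm ▸ pow_dvd_pow_of_dvd (dvd_mul_right _ _) 3)
  exact hp.one_lt.ne' (hcf p (by exact_mod_cast hdvd))

/-- Since the degree `3` is not a sum of products `e f` with all `f ≥ 2` unless `p` is inert, there
is a prime of degree one above every `p ≡ 2 mod 3`. -/
theorem IsPureCubicField.exists_absNorm_eq (hK : IsPureCubicField K) {p : ℕ} (hp : p.Prime)
    (hp3 : p % 3 = 2) : ∃ P : Ideal (𝓞 K), Ideal.absNorm P = p := by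
  have hfin := hK.finrank_eq_three
  have hnot := hK.not_isPrime_span hp hp3
  have hN : Ideal.absNorm (Ideal.span {(p : 𝓞 K)}) = p ^ 3 := by
    rw [Ideal.absNorm_span_natCast, RingOfIntegers.rank, hfin]
  have htop : Ideal.span {(p : 𝓞 K)} ≠ ⊤ := by
    rw [Ne, ← Ideal.absNorm_eq_one_iff, hN]
    exact (Nat.one_lt_pow three_ne_zero hp.one_lt).ne'
  obtain ⟨P, hPmax, hle⟩ := Ideal.exists_le_maximal _ htop
  obtain ⟨Q, hQ⟩ := Ideal.dvd_iff_le.mpr hle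
  rw [hQ, map_mul] at hN
  obtain ⟨k, hk, hPk⟩ := (Nat.dvd_prime_pow hp).mp (Dvd.intro _ hN)
  interval_cases k
  · rw [pow_zero, Ideal.absNorm_eq_one_iff] at hPk
    exact absurd hPk hPmax.ne_top
  · exact ⟨P, by simpa using hPk⟩
  · refine ⟨Q, Nat.eq_of_mul_eq_mul_left (pow_pos hp.pos 2) ?_⟩
    rw [← hPk, hN, hPk]
    ring
  · have hQ1 : Ideal.absNorm Q = 1 := by
      refine Nat.eq_of_mul_eq_mul_left (pow_pos hp.pos 3) ?_
      rw [← hPk, hN, hPk, mul_one]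
    rw [Ideal.absNorm_eq_one_iff] at hQ1
    rw [hQ1, Ideal.mul_top] at hQ
    rw [hQ] at hnot
    exact absurd hPmax.isPrime hnot

end PureCubic

/-! ### Elements generating a quotient of powers of prime ideals -/

section Discriminant

open Module

variable {K : Type*} [Field K] [NumberField K]

/-- The discriminant of a fractional ideal `I` is `discr K * N(I) ^ 2`, and a basis of `K` contained
in `I` spans a sublattice of it. -/
lemma abs_discr_mul_absNorm_sq_le {ι : Type*} [Fintype ι] [DecidableEq ι]
    (I : (FractionalIdeal (nonZeroDivisors (𝓞 K)) K)ˣ) (b : Basis ι ℚ K)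
    (hb : ∀ i, b i ∈ (I : FractionalIdeal (nonZeroDivisors (𝓞 K)) K)) :
    |(discr K : ℚ)| * FractionalIdeal.absNorm I.1 ^ 2 ≤ |Algebra.discr ℚ b| := by
  classical
  let e := (integralBasis K).indexEquiv (basisOfFractionalIdeal K I)
  set f := (basisOfFractionalIdeal K I).reindex e.symm with hf
  let b' := b.reindex (b.indexEquiv (integralBasis K))
  have hb' (i) : b' i ∈ (I : FractionalIdeal (nonZeroDivisors (𝓞 K)) K) := by
    simp only [b', Basis.reindex_apply]
    exact hb _
  have hbb' : Algebra.discr ℚ b' = Algebra.discr ℚ b := by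
    rw [← Algebra.discr_reindex ℚ b (b.indexEquiv (integralBasis K))]
    simp [b', Basis.coe_reindex]
  have hint : ∃ P : Matrix _ _ ℤ, f.toMatrix b' = P.map (algebraMap ℤ ℚ) := by
    have hmem (i) : b' i ∈ Submodule.span ℤ (Set.range f) := by
      rw [hf, Basis.range_reindex, mem_span_basisOfFractionalIdeal]
      exact hb' i
    have h (i j) : ∃ z : ℤ, f.toMatrix b' i j = z := by
      obtain ⟨z, hz⟩ := (f.mem_span_iff_repr_mem ℤ _).mp (hmem j) i
      exact ⟨z, by rw [Basis.toMatrix_apply, ← hz]; simp⟩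
    choose P hP using h
    exact ⟨Matrix.of P, by ext i j; simp [hP]⟩
  obtain ⟨P, hP⟩ := hint
  have e1 := Algebra.discr_of_matrix_vecMul (f : _ → K) (f.toMatrix b')
  rw [Basis.toMatrix_map_vecMul, hbb'] at e1
  have e2 := Algebra.discr_of_matrix_vecMul (integralBasis K : _ → K)
    ((integralBasis K).toMatrix f)
  rw [Basis.toMatrix_map_vecMul, ← coe_discr, ← Basis.det_apply, ← sq_abs,
    det_basisOfFractionalIdeal_eq_absNorm K I e] at e2
  -- The squared index of the lattice spanned by `b` in the ideal is a positive integer.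
  have hdet : (1 : ℚ) ≤ (f.toMatrix b').det ^ 2 := by
    have h0 : (f.toMatrix b').det ≠ 0 := by
      intro h0
      rw [h0] at e1
      exact Algebra.discr_not_zero_of_basis ℚ b (by simp [e1])
    rw [hP, ← RingHom.mapMatrix_apply, ← RingHom.map_det, eq_intCast] at h0 ⊢
    have h1 : P.det ≠ 0 := fun h ↦ h0 (by rw [h]; simp)
    have h2 : 1 ≤ P.det ^ 2 := by
      have := sq_pos_of_ne_zero h1
      linarith
    exact_mod_cast h2
  rw [e1, e2, abs_mul, abs_mul, abs_sq, abs_sq]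
  have h3 : 0 ≤ |(discr K : ℚ)| * FractionalIdeal.absNorm I.1 ^ 2 := by positivity
  calc _ ≤ (f.toMatrix b').det ^ 2 * (|(discr K : ℚ)| * FractionalIdeal.absNorm I.1 ^ 2) :=
        le_mul_of_one_le_left h3 hdet
    _ = _ := by ring

lemma norm_det_le_of_norm_row_le {n : Type*} [Fintype n] [DecidableEq n] (M : Matrix n n ℂ)
    (r : n → ℝ) (h : ∀ i j, ‖M i j‖ ≤ r i) :
    ‖M.det‖ ≤ (Fintype.card n).factorial * ∏ i, r i := by
  rw [Matrix.det_apply]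
  refine (norm_sum_le _ _).trans ?_
  refine (Finset.sum_le_card_nsmul _ _ (∏ i, r i) fun σ _ ↦ ?_).trans (le_of_eq ?_)
  · rw [Units.smul_def, zsmul_eq_mul, norm_mul, norm_prod]
    have hs : ‖((Equiv.Perm.sign σ : ℤ) : ℂ)‖ = 1 := by
      rcases Int.units_eq_one_or (Equiv.Perm.sign σ) with h | h <;> simp [h]
    rw [hs, one_mul, ← Equiv.prod_comp σ r]
    exact Finset.prod_le_prod (fun _ _ ↦ norm_nonneg _) fun i _ ↦ h _ _
  · rw [nsmul_eq_mul, Finset.card_univ, Fintype.card_perm]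

lemma abs_discr_powers_le (hK : finrank ℚ K = 3) {δ : K} {A : ℝ}
    (hA : ∀ v : InfinitePlace K, v δ ≤ A) :
    |((Algebra.discr ℚ fun i : Fin 3 ↦ δ ^ (i : ℕ) : ℚ) : ℝ)| ≤ 36 * A ^ 6 := by
  have hc : Fintype.card (K →ₐ[ℚ] ℂ) = Fintype.card (Fin 3) := by
    rw [AlgHom.card, hK, Fintype.card_fin]
  let e : Fin 3 ≃ (K →ₐ[ℚ] ℂ) := (Fintype.equivOfCardEq hc).symm
  have h1 := Algebra.discr_eq_det_embeddingsMatrixReindex_pow_two ℚ ℂ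
    (fun i : Fin 3 ↦ δ ^ (i : ℕ)) e
  have h2 := norm_det_le_of_norm_row_le
    (Algebra.embeddingsMatrixReindex ℚ ℂ (fun i : Fin 3 ↦ δ ^ (i : ℕ)) e)
    (fun i ↦ A ^ (i : ℕ)) fun i j ↦ by
      have : Algebra.embeddingsMatrixReindex ℚ ℂ (fun i : Fin 3 ↦ δ ^ (i : ℕ)) e i j =
        e j δ ^ (i : ℕ) := by
        simp [Algebra.embeddingsMatrixReindex, Algebra.embeddingsMatrix]
      rw [this, norm_pow]
      exact pow_le_pow_left₀ (norm_nonneg _) (hA (InfinitePlace.mk (e j : K →+* ℂ))) _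
  have h3 := congrArg norm h1
  rw [norm_pow, eq_ratCast, Complex.norm_ratCast] at h3
  rw [h3]
  have h4 : ∏ i : Fin 3, A ^ (i : ℕ) = A ^ 3 := by
    rw [Fin.prod_univ_three]
    simp
    ring
  rw [h4, Fintype.card_fin] at h2
  calc _ ≤ ((Nat.factorial 3 : ℕ) * A ^ 3) ^ 2 := pow_le_pow_left₀ (norm_nonneg _) h2 2
    _ = 36 * A ^ 6 := by norm_num [Nat.factorial]; ring

lemma linearIndependent_powers (hK : finrank ℚ K = 3) {δ : K} (hδ : ∀ r : ℚ, (r : K) ≠ δ) :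
    LinearIndependent ℚ fun i : Fin 3 ↦ δ ^ (i : ℕ) := by
  have hdeg : (minpoly ℚ δ).natDegree = 3 := by
    have h1 := minpoly.degree_dvd (K := ℚ) (x := δ) (Algebra.IsIntegral.isIntegral δ)
    rw [hK] at h1
    refine ((Nat.dvd_prime Nat.prime_three).mp h1).resolve_left fun h ↦ ?_
    obtain ⟨r, hr⟩ := minpoly.natDegree_eq_one_iff.mp h
    exact hδ r (by simpa using hr)
  have h := linearIndependent_pow (K := ℚ) δ
  rw [hdeg] at h
  exact h

/-- If `P ^ 3 ∣ (p)` then `P ^ 2` divides the different, whose norm is the discriminant. -/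
lemma not_pow_three_dvd_of_not_dvd_discr {p : ℕ} (hp : p.Prime) (hpD : ¬ (p : ℤ) ∣ discr K)
    {P : Ideal (𝓞 K)} (hP : Ideal.absNorm P = p) : ¬ P ^ 3 ∣ Ideal.span {(p : 𝓞 K)} := by
  intro h
  have hpZ : Prime (p : ℤ) := Nat.prime_iff_prime_int.mp hp
  have hbot : Ideal.span {(p : ℤ)} ≠ ⊥ := by
    rw [Ne, Ideal.span_singleton_eq_bot]
    exact hpZ.ne_zero
  have : (Ideal.span {(p : ℤ)}).IsMaximal :=
    ((Ideal.span_singleton_prime hpZ.ne_zero).mpr hpZ).isMaximal hbot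
  have h1 := pow_sub_one_dvd_differentIdeal ℤ (p := Ideal.span {(p : ℤ)}) P 3 hbot
    (by rw [Ideal.map_span]; simpa using h)
  have h2 := map_dvd Ideal.absNorm h1
  rw [absNorm_differentIdeal K, map_pow, hP] at h2
  exact hpD (Int.natCast_dvd.mpr ((dvd_pow_self p two_ne_zero).trans h2))

/-- If the quotient of `P ^ ℓ` and `Q ^ ℓ` is generated by a rational number then, by taking norms,
`3 ∣ ℓ` and the prime `p` is totally ramified. -/
lemma rat_mul_ne_of_span_mul_pow_eq (hK : finrank ℚ K = 3) {ℓ p q : ℕ} (hℓ : ℓ.Prime)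
    (hp : p.Prime) (hq : q.Prime) (hpq : p ≠ q) (hpD : ¬ (p : ℤ) ∣ discr K) {P Q : Ideal (𝓞 K)}
    (hP : Ideal.absNorm P = p) (hQ : Ideal.absNorm Q = q) {α β : 𝓞 K} (hβ : β ≠ 0)
    (h : Ideal.span {α} * P ^ ℓ = Ideal.span {β} * Q ^ ℓ) (r : ℚ) : (r : K) * β ≠ α := by
  intro hr
  have h1 : (r.den : 𝓞 K) * α = r.num * β := by
    apply RingOfIntegers.coe_injective
    simp only [map_mul, map_natCast, map_intCast]
    have hr' : (r : K) * algebraMap (𝓞 K) K β = algebraMap (𝓞 K) K α := hr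
    have hden : (r.den : K) ≠ 0 := by exact_mod_cast r.den_ne_zero
    rw [← hr', ← mul_assoc]
    congr 1
    exact_mod_cast Rat.den_mul_eq_num r
  have h2 : Ideal.span {(r.num : 𝓞 K)} * P ^ ℓ = Ideal.span {(r.den : 𝓞 K)} * Q ^ ℓ := by
    refine mul_left_cancel₀ (a := Ideal.span {β}) ?_ ?_
    · rwa [Ne, Ideal.zero_eq_bot, Ideal.span_singleton_eq_bot]
    · calc _ = Ideal.span {(r.num : 𝓞 K) * β} * P ^ ℓ := by
            rw [← Ideal.span_singleton_mul_span_singleton]; ring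
        _ = Ideal.span {(r.den : 𝓞 K)} * (Ideal.span {α} * P ^ ℓ) := by
            rw [← h1, ← Ideal.span_singleton_mul_span_singleton]; ring
        _ = _ := by rw [h]; ring
  have h3 := congrArg Ideal.absNorm h2
  rw [map_mul, map_mul, map_pow, map_pow, hP, hQ, Ideal.absNorm_span_natCast,
    Ideal.absNorm_span_singleton, show (r.num : 𝓞 K) = algebraMap ℤ (𝓞 K) r.num by simp,
    Algebra.norm_algebraMap, RingOfIntegers.rank, hK, Int.natAbs_pow] at h3
  have c1 : (r.den ^ 3).Coprime (r.num.natAbs ^ 3) := (r.reduced.pow 3 3).symm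
  have c2 : (p ^ ℓ).Coprime (q ^ ℓ) := ((Nat.coprime_primes hp hq).mpr hpq).pow ℓ ℓ
  have d1 : r.den ^ 3 ∣ p ^ ℓ := c1.dvd_of_dvd_mul_left (Dvd.intro _ h3.symm)
  have d2 : p ^ ℓ ∣ r.den ^ 3 := c2.dvd_of_dvd_mul_right (Dvd.intro_left _ h3)
  have d3 : r.den ^ 3 = p ^ ℓ := Nat.dvd_antisymm d1 d2
  obtain ⟨m, -, hm⟩ := (Nat.dvd_prime_pow hp).mp ((dvd_pow_self r.den three_ne_zero).trans d1)
  rw [hm, ← pow_mul] at d3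
  have hm3 : m * 3 = ℓ := Nat.pow_right_injective hp.two_le d3
  have hℓ3 : 3 = ℓ := (Nat.prime_dvd_prime_iff_eq Nat.prime_three hℓ).mp (Dvd.intro_left _ hm3)
  have hm1 : m = 1 := by omega
  rw [hm, hm1, pow_one, ← hℓ3] at h2
  refine not_pow_three_dvd_of_not_dvd_discr hp hpD hP ?_
  have hP0 : P ≠ ⊥ := by
    rintro rfl
    rw [Ideal.absNorm_bot] at hP
    exact hp.ne_zero hP.symm
  have hPprime : Prime P :=
    Ideal.prime_of_isPrime hP0 (Ideal.isPrime_of_irreducible_absNorm (by rw [hP]; exact hp))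
  refine hPprime.pow_dvd_of_dvd_mul_right 3 (fun hd ↦ hpq ?_) (Dvd.intro_left _ h2)
  have := map_dvd Ideal.absNorm (hPprime.dvd_of_dvd_pow hd)
  rw [hP, hQ] at this
  exact (Nat.prime_dvd_prime_iff_eq hp hq).mp this

lemma exists_pow_mul_eq_of_span_mul_pow_eq {R : Type*} [CommRing R] {ℓ i : ℕ}
    {P Q : Ideal R} {α β : R}
    (h : Ideal.span {α} * P ^ ℓ = Ideal.span {β} * Q ^ ℓ) (hi : i ≤ 2) {y : R}
    (hy : y ∈ P ^ (2 * ℓ)) : ∃ z, α ^ i * y = β ^ i * z := by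
  refine Ideal.mem_span_singleton.mp ?_
  have h2 : α ^ i * y ∈ (Ideal.span {α} * P ^ ℓ) ^ i := by
    rw [mul_pow, Ideal.span_singleton_pow, ← pow_mul]
    refine Ideal.mul_mem_mul (Ideal.mem_span_singleton_self _) (Ideal.pow_le_pow_right ?_ hy)
    rw [mul_comm]
    exact Nat.mul_le_mul_right _ hi
  rw [h, mul_pow, Ideal.span_singleton_pow] at h2
  exact Ideal.mul_le_left h2

/-- A generator `δ` of the quotient of `Q ^ ℓ` and `P ^ ℓ` cannot be small at all infinite places:
the powers `1, δ, δ ^ 2` are independent and lie in the fractional ideal `P ^ (-2ℓ)`, whose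
discriminant is known. -/
theorem abs_discr_le_of_span_mul_pow_eq (hK : finrank ℚ K = 3) {ℓ p q : ℕ} (hℓ : ℓ.Prime)
    (hp : p.Prime) (hq : q.Prime) (hpq : p ≠ q) (hpD : ¬ (p : ℤ) ∣ discr K) {P Q : Ideal (𝓞 K)}
    (hP : Ideal.absNorm P = p) (hQ : Ideal.absNorm Q = q) {α β : 𝓞 K} (hβ : β ≠ 0)
    (h : Ideal.span {α} * P ^ ℓ = Ideal.span {β} * Q ^ ℓ) {A : ℝ}
    (hA : ∀ v : InfinitePlace K, v α ≤ A * v β) :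
    |(discr K : ℝ)| ≤ 36 * A ^ 6 * p ^ (4 * ℓ) := by
  have hβK : (β : K) ≠ 0 := by exact_mod_cast hβ
  set δ : K := α / β with hδ
  have hδr (r : ℚ) : (r : K) ≠ δ := by
    intro hr
    rw [hδ, eq_div_iff hβK] at hr
    exact rat_mul_ne_of_span_mul_pow_eq hK hℓ hp hq hpq hpD hP hQ hβ h r hr
  have hδA (v : InfinitePlace K) : v δ ≤ A := by
    rw [hδ, map_div₀, div_le_iff₀ (by rwa [v.pos_iff])]
    exact hA v
  have hP0 : P ≠ ⊥ := by
    rintro rfl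
    rw [Ideal.absNorm_bot] at hP
    exact hp.ne_zero hP.symm
  let b := basisOfLinearIndependentOfCardEqFinrank (linearIndependent_powers hK hδr)
    (by rw [Fintype.card_fin, hK])
  have hbcoe : (b : Fin 3 → K) = fun i : Fin 3 ↦ δ ^ (i : ℕ) := by simp [b]
  have hJ : ((P ^ (2 * ℓ) : Ideal (𝓞 K)) : FractionalIdeal (nonZeroDivisors (𝓞 K)) K) ≠ 0 := by
    rw [Ne, FractionalIdeal.coeIdeal_eq_zero]
    exact pow_ne_zero _ hP0
  have hmem (i : Fin 3) : b i ∈ ((Units.mk0 _ hJ)⁻¹ : (FractionalIdeal _ K)ˣ).1 := by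
    rw [hbcoe, Units.val_inv_eq_inv_val, Units.val_mk0, FractionalIdeal.mem_inv_iff hJ]
    intro y hy
    obtain ⟨y', hy', rfl⟩ := (FractionalIdeal.mem_coeIdeal _).mp hy
    obtain ⟨z, hz⟩ := exists_pow_mul_eq_of_span_mul_pow_eq h (i := i) (by omega) hy'
    rw [FractionalIdeal.mem_one_iff]
    refine ⟨z, ?_⟩
    have hz' := congrArg (algebraMap (𝓞 K) K) hz
    rw [map_mul, map_mul, map_pow, map_pow] at hz'
    beta_reduce
    rw [hδ, div_pow, div_mul_eq_mul_div, eq_div_iff (pow_ne_zero _ hβK), mul_comm]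
    exact hz'.symm
  have h1 := abs_discr_mul_absNorm_sq_le _ b hmem
  rw [hbcoe, Units.val_inv_eq_inv_val, Units.val_mk0, map_inv₀, FractionalIdeal.coeIdeal_absNorm,
    map_pow, hP] at h1
  have h2 := abs_discr_powers_le hK hδA
  have h3 : (|(discr K : ℝ)| * (((p : ℝ) ^ (2 * ℓ))⁻¹) ^ 2) ≤
      |((Algebra.discr ℚ fun i : Fin 3 ↦ δ ^ (i : ℕ) : ℚ) : ℝ)| := by
    have := (Rat.cast_le (K := ℝ)).mpr h1
    push_cast at this
    exact this
  have hpp : (0 : ℝ) < (p : ℝ) ^ (4 * ℓ) := by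
    have : (0 : ℝ) < p := by exact_mod_cast hp.pos
    positivity
  have h4 : (((p : ℝ) ^ (2 * ℓ))⁻¹) ^ 2 = ((p : ℝ) ^ (4 * ℓ))⁻¹ := by
    rw [inv_pow, ← pow_mul]
    congr 2
    ring
  rw [h4, ← div_eq_mul_inv] at h3
  rw [← div_le_iff₀ hpp]
  exact h3.trans h2

end Discriminant

/-! ### Reduced ideals and the pigeonhole argument -/

section Pigeonhole

open Module

variable {K : Type*} [Field K] [NumberField K]

/-- Minkowski's theorem for an ideal and a box, with a constant that does not involve the
signature. -/
lemma exists_mem_ideal_lt {I : Ideal (𝓞 K)} (hI : I ≠ ⊥) {f : InfinitePlace K → ℝ}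
    (hf : ∀ v, 0 ≤ f v)
    (h : 2 ^ finrank ℚ K * √|(discr K : ℝ)| * Ideal.absNorm I < ∏ v, f v ^ v.mult) :
    ∃ a ∈ I, a ≠ 0 ∧ ∀ v : InfinitePlace K, v a < f v := by
  have hI' : (I : FractionalIdeal (nonZeroDivisors (𝓞 K)) K) ≠ 0 := by
    rwa [Ne, FractionalIdeal.coeIdeal_eq_zero]
  let g : InfinitePlace K → NNReal := fun v ↦ ⟨f v, hf v⟩
  obtain ⟨a, ha, ha0, hav⟩ := mixedEmbedding.exists_ne_zero_mem_ideal_lt K (f := g)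
    (Units.mk0 _ hI') (by
      rw [mixedEmbedding.convexBodyLT_volume]
      refine lt_of_lt_of_le ?_ (le_mul_of_one_le_left zero_le
        (by exact_mod_cast mixedEmbedding.one_le_convexBodyLTFactor K))
      rw [mixedEmbedding.minkowskiBound,
        mixedEmbedding.volume_fundamentalDomain_fractionalIdealLatticeBasis,
        mixedEmbedding.volume_fundamentalDomain_latticeBasis, mixedEmbedding.finrank]
      have hN : ((FractionalIdeal.absNorm (Units.mk0 _ hI').1 : ℚ) : ℝ) = Ideal.absNorm I := by
        rw [Units.val_mk0, FractionalIdeal.coeIdeal_absNorm, Rat.cast_natCast]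
      have hD : ((NNReal.sqrt ‖discr K‖₊ : NNReal) : ENNReal) =
          ENNReal.ofReal √|(discr K : ℝ)| := by
        rw [← ENNReal.ofReal_coe_nnreal, Real.coe_sqrt, coe_nnnorm, Int.norm_eq_abs]
      have hg : ((∏ v, g v ^ v.mult : NNReal) : ENNReal) = ENNReal.ofReal (∏ v, f v ^ v.mult) := by
        rw [← ENNReal.ofReal_coe_nnreal]
        congr 1
        push_cast
        rfl
      rw [hN, hD, hg]
      calc _ ≤ ENNReal.ofReal (Ideal.absNorm I) * (1 * ENNReal.ofReal √|(discr K : ℝ)|) *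
            2 ^ finrank ℚ K := by
            gcongr
            exact pow_le_one₀ zero_le (by simp)
        _ = ENNReal.ofReal (2 ^ finrank ℚ K * √|(discr K : ℝ)| * Ideal.absNorm I) := by
            rw [ENNReal.ofReal_mul (by positivity), ENNReal.ofReal_mul (by positivity),
              ENNReal.ofReal_pow (by norm_num), ENNReal.ofReal_ofNat]
            ring
        _ < _ := (ENNReal.ofReal_lt_ofReal_iff_of_nonneg (by positivity)).mpr h)
  obtain ⟨a, haI, rfl⟩ := (FractionalIdeal.mem_coeIdeal _).mp ha
  exact ⟨a, haI, by simpa using ha0, hav⟩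

/-- The weights at the infinite places attached to a generator of `I ^ ℓ` have product `N(I)`. -/
lemma prod_rpow_inv_pow_mult {ℓ : ℕ} (hℓ : ℓ ≠ 0) {I : Ideal (𝓞 K)} {α : 𝓞 K}
    (hI : I ^ ℓ = Ideal.span {α}) :
    ∏ v : InfinitePlace K, ((v α) ^ (ℓ : ℝ)⁻¹) ^ v.mult = Ideal.absNorm I := by
  refine (pow_left_inj₀ (Finset.prod_nonneg fun v _ ↦ by positivity) (Nat.cast_nonneg _) hℓ).mp ?_
  have h1 (v : InfinitePlace K) : (((v α) ^ (ℓ : ℝ)⁻¹) ^ v.mult) ^ ℓ = v α ^ v.mult := by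
    rw [pow_right_comm, Real.rpow_inv_natCast_pow (apply_nonneg _ _) hℓ]
  rw [← Finset.prod_pow]
  simp only [h1]
  rw [InfinitePlace.prod_eq_abs_norm, ← Nat.cast_pow, ← map_pow, hI,
    Ideal.absNorm_span_singleton, ← Algebra.coe_norm_int]
  simp [Nat.cast_natAbs]

/-- Minkowski's theorem for the ideal `I P`, with the infinite places weighted by the absolute
values of a generator `α` of `I ^ ℓ`. The bound from below at each place holds because the norm of
`B` is at least `1`. -/
lemma exists_span_eq_mul_mul (hK : finrank ℚ K = 3) {ℓ p : ℕ} (hℓ : ℓ ≠ 0) (hp : p ≠ 0)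
    {I P : Ideal (𝓞 K)} {α : 𝓞 K} (hα : α ≠ 0) (hI : I ^ ℓ = Ideal.span {α})
    (hP : Ideal.absNorm P = p) {Y : ℝ} (hY : Y = 9 * √|(discr K : ℝ)|) :
    ∃ (γ : 𝓞 K) (B : Ideal (𝓞 K)), γ ≠ 0 ∧ Ideal.span {γ} = I * P * B ∧ B ≠ ⊥ ∧
      (Ideal.absNorm B : ℝ) ≤ Y ∧ ∀ v : InfinitePlace K, ∃ r : ℝ,
        v γ = r * (v α) ^ (ℓ : ℝ)⁻¹ * (Y * p) ^ (3 : ℝ)⁻¹ ∧ Y⁻¹ ≤ r ∧ r ≤ 1 := by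
  have hD : 0 < √|(discr K : ℝ)| := by
    have := discr_ne_zero K
    positivity
  have hY0 : 0 < Y := by rw [hY]; positivity
  have hp0 : (0 : ℝ) < p := by positivity
  set t : ℝ := (Y * p) ^ (3 : ℝ)⁻¹ with ht
  have ht0 : 0 < t := by positivity
  have ht3 : t ^ 3 = Y * p := by
    rw [ht]
    exact_mod_cast Real.rpow_inv_natCast_pow (by positivity : 0 ≤ Y * p) three_ne_zero
  have hx0 (v : InfinitePlace K) : 0 < (v α) ^ (ℓ : ℝ)⁻¹ :=
    Real.rpow_pos_of_pos (v.pos_iff.mpr (by simpa using hα)) _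
  have hI0 : I ≠ ⊥ := by
    rintro rfl
    rw [← Ideal.zero_eq_bot, zero_pow hℓ, Ideal.zero_eq_bot, eq_comm,
      Ideal.span_singleton_eq_bot] at hI
    exact hα hI
  have hP0 : P ≠ ⊥ := by
    rintro rfl
    rw [Ideal.absNorm_bot] at hP
    exact hp hP.symm
  have hNI : (0 : ℝ) < Ideal.absNorm I := by
    exact_mod_cast Nat.pos_of_ne_zero fun h ↦ hI0 (Ideal.absNorm_eq_zero_iff.mp h)
  have hprod : ∏ v : InfinitePlace K, ((v α) ^ (ℓ : ℝ)⁻¹ * t) ^ v.mult =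
      Ideal.absNorm I * (Y * p) := by
    simp only [mul_pow]
    rw [Finset.prod_mul_distrib, prod_rpow_inv_pow_mult hℓ hI, Finset.prod_pow_eq_pow_sum,
      InfinitePlace.sum_mult_eq, hK, ht3]
  -- The box has volume at least `9 √D N(I P)`, more than the `8 √D N(I P)` that Minkowski's theorem
  -- needs in degree `3`.
  obtain ⟨γ, hγ, hγ0, hγv⟩ := exists_mem_ideal_lt (I := I * P) (mul_ne_zero hI0 hP0)
    (f := fun v ↦ (v α) ^ (ℓ : ℝ)⁻¹ * t) (fun v ↦ (mul_pos (hx0 v) ht0).le) (by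
      rw [hprod, hK, map_mul, hP, hY]
      push_cast
      have : 0 < √|(discr K : ℝ)| * (Ideal.absNorm I * p) := by positivity
      linarith)
  obtain ⟨B, hB⟩ := Ideal.dvd_iff_le.mpr ((Ideal.span_singleton_le_iff_mem _).mpr hγ)
  have hB0 : B ≠ ⊥ := by
    rintro rfl
    rw [Ideal.mul_bot, Ideal.span_singleton_eq_bot] at hB
    exact hγ0 hB
  set r : InfinitePlace K → ℝ := fun v ↦ v γ / ((v α) ^ (ℓ : ℝ)⁻¹ * t) with hr
  have hr0 (v) : 0 ≤ r v := div_nonneg (apply_nonneg _ _) (mul_pos (hx0 v) ht0).le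
  have hr1 (v) : r v ≤ 1 := (div_le_one (mul_pos (hx0 v) ht0)).mpr (hγv v).le
  have hrprod : ∏ v, r v ^ v.mult = Ideal.absNorm B / Y := by
    have hn : ∏ v : InfinitePlace K, v γ ^ v.mult =
        Ideal.absNorm I * p * Ideal.absNorm B := by
      have := congrArg Ideal.absNorm hB
      rw [map_mul, map_mul, hP, Ideal.absNorm_span_singleton] at this
      rw [InfinitePlace.prod_eq_abs_norm, ← Algebra.coe_norm_int]
      have h2 : ((Algebra.norm ℤ γ).natAbs : ℝ) = Ideal.absNorm I * p * Ideal.absNorm B := by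
        exact_mod_cast this
      rw [← h2]
      simp [Nat.cast_natAbs]
    simp only [hr, div_pow]
    rw [Finset.prod_div_distrib, hn, hprod]
    field_simp
  have hB1 : (1 : ℝ) ≤ Ideal.absNorm B := by
    exact_mod_cast Nat.one_le_iff_ne_zero.mpr fun h ↦ hB0 (Ideal.absNorm_eq_zero_iff.mp h)
  refine ⟨γ, B, hγ0, hB, hB0, ?_, fun v ↦ ⟨r v, ?_, ?_, hr1 v⟩⟩
  · rw [← div_le_one hY0, ← hrprod]
    exact Finset.prod_le_one (fun v _ ↦ pow_nonneg (hr0 v) _) fun v _ ↦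
      pow_le_one₀ (hr0 v) (hr1 v)
  · rw [mul_assoc, hr]
    exact (div_mul_cancel₀ _ (mul_pos (hx0 v) ht0).ne').symm
  · classical
    calc Y⁻¹ ≤ Ideal.absNorm B / Y := by
          rw [inv_eq_one_div]
          gcongr
      _ = ∏ v, r v ^ v.mult := hrprod.symm
      _ = r v ^ v.mult * ∏ w ∈ Finset.univ.erase v, r w ^ w.mult :=
          (Finset.mul_prod_erase _ _ (Finset.mem_univ v)).symm
      _ ≤ r v ^ v.mult * 1 := by
          refine mul_le_mul_of_nonneg_left ?_ (pow_nonneg (hr0 v) _)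
          exact Finset.prod_le_one (fun w _ ↦ pow_nonneg (hr0 w) _) fun w _ ↦
            pow_le_one₀ (hr0 w) (hr1 w)
      _ ≤ r v := by
          rw [mul_one]
          exact pow_le_of_le_one (hr0 v) (hr1 v) InfinitePlace.mult_ne_zero

lemma card_infinitePlace_le (hK : finrank ℚ K = 3) : Fintype.card (InfinitePlace K) ≤ 3 := by
  rw [← hK, ← InfinitePlace.sum_mult_eq, ← Finset.card_univ, Finset.card_eq_sum_ones]
  exact Finset.sum_le_sum fun v _ ↦ InfinitePlace.mult_pos

lemma exists_ideal_of_mem_classGroupTorsion {ℓ : ℕ} {c : ClassGroup (𝓞 K)}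
    (hc : c ∈ classGroupTorsion ℓ K) : ∃ (I : nonZeroDivisors (Ideal (𝓞 K))) (α : 𝓞 K),
      ClassGroup.mk0 I = c ∧ α ≠ 0 ∧ (I : Ideal (𝓞 K)) ^ ℓ = Ideal.span {α} := by
  obtain ⟨I, rfl⟩ := ClassGroup.mk0_surjective c
  have h1 : ClassGroup.mk0 (I ^ ℓ) = 1 := by
    rw [map_pow]
    exact hc
  obtain ⟨α, hα⟩ := (ClassGroup.mk0_eq_one_iff (I ^ ℓ).2).mp h1
  rw [SubmonoidClass.coe_pow] at hα
  refine ⟨I, α, rfl, ?_, hα⟩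
  rintro rfl
  have h2 : (I : Ideal (𝓞 K)) ^ ℓ = 0 := by
    rw [hα]
    simp
  exact pow_ne_zero _ (nonZeroDivisors.coe_ne_zero I) h2

/-- If the same ideal `B` arises from two different primes, with nearly the same position at the
infinite places, then the quotient of the `ℓ`-th powers of the primes has a small generator, so the
discriminant is small. -/
lemma abs_discr_le_of_collision (hK : finrank ℚ K = 3) {ℓ p q : ℕ} (hℓ : ℓ.Prime)
    (hp : p.Prime) (hq : q.Prime) (hpq : p ≠ q) (hpD : ¬ (p : ℤ) ∣ discr K)
    {P Q I J B : Ideal (𝓞 K)} {α β γ δ : 𝓞 K} (hP : Ideal.absNorm P = p)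
    (hQ : Ideal.absNorm Q = q) (hβ : β ≠ 0) (hI : I ^ ℓ = Ideal.span {α})
    (hJ : J ^ ℓ = Ideal.span {β}) (hγ : γ ≠ 0) (hγB : Ideal.span {γ} = I * P * B)
    (hδB : Ideal.span {δ} = J * Q * B) {Y : ℝ} (hY : 0 < Y)
    (h : ∀ v : InfinitePlace K, ∃ r s : ℝ,
      v γ = r * (v α) ^ (ℓ : ℝ)⁻¹ * (Y * p) ^ (3 : ℝ)⁻¹ ∧
      v δ = s * (v β) ^ (ℓ : ℝ)⁻¹ * (Y * q) ^ (3 : ℝ)⁻¹ ∧ 0 ≤ s ∧ s ≤ Real.exp 1 * r) :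
    |(discr K : ℝ)| ≤ 36 * Real.exp 1 ^ (6 * ℓ) * (p * q) ^ (2 * ℓ) := by
  have hp0 : (0 : ℝ) < p := by exact_mod_cast hp.pos
  have hq0 : (0 : ℝ) < q := by exact_mod_cast hq.pos
  have hℓ0 := hℓ.ne_zero
  set t := (Y * p) ^ (3 : ℝ)⁻¹ with ht
  set u := (Y * q) ^ (3 : ℝ)⁻¹ with hu
  have ht0 : 0 < t := by positivity
  have hu0 : 0 < u := by positivity
  have ht3 : t ^ 3 = Y * p := by
    exact_mod_cast Real.rpow_inv_natCast_pow (by positivity : 0 ≤ Y * p) three_ne_zero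
  have hu3 : u ^ 3 = Y * q := by
    exact_mod_cast Real.rpow_inv_natCast_pow (by positivity : 0 ≤ Y * q) three_ne_zero
  have hspan : Ideal.span {δ ^ ℓ * α} * P ^ ℓ = Ideal.span {γ ^ ℓ * β} * Q ^ ℓ := by
    rw [← Ideal.span_singleton_mul_span_singleton, ← Ideal.span_singleton_mul_span_singleton,
      ← Ideal.span_singleton_pow, ← Ideal.span_singleton_pow, hγB, hδB, ← hI, ← hJ]
    ring
  -- The weights at the infinite places cancel in the `ℓ`-th powers; what is left of the sizes is the
  -- ratio of the two Minkowski radii and the rounding error `exp 1`.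
  have hmain := abs_discr_le_of_span_mul_pow_eq hK hℓ hp hq hpq hpD hP hQ
    (mul_ne_zero (pow_ne_zero ℓ hγ) hβ) hspan (A := (Real.exp 1 * (u / t)) ^ ℓ) (fun v ↦ by
      obtain ⟨r, s, hr, hs, hs0, hsr⟩ := h v
      have e1 : ((v α) ^ (ℓ : ℝ)⁻¹) ^ ℓ = v α := Real.rpow_inv_natCast_pow (apply_nonneg _ _) hℓ0
      have e2 : ((v β) ^ (ℓ : ℝ)⁻¹) ^ ℓ = v β := Real.rpow_inv_natCast_pow (apply_nonneg _ _) hℓ0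
      push_cast
      rw [map_mul, map_mul, map_pow, map_pow, hr, hs]
      simp only [mul_pow, e1, e2]
      have h1 : s * u ≤ Real.exp 1 * (u / t) * (r * t) := by
        calc s * u ≤ Real.exp 1 * r * u := by gcongr
          _ = _ := by field_simp
      calc s ^ ℓ * v β * u ^ ℓ * v α = (s * u) ^ ℓ * (v α * v β) := by rw [mul_pow]; ring
        _ ≤ (Real.exp 1 * (u / t) * (r * t)) ^ ℓ * (v α * v β) := by gcongr
        _ = _ := by simp only [mul_pow]; ring)
  refine hmain.trans (le_of_eq ?_)
  have h6 : (u / t) ^ (6 * ℓ) = (q / p : ℝ) ^ (2 * ℓ) := by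
    rw [show 6 * ℓ = 3 * (2 * ℓ) by ring, pow_mul, div_pow, ht3, hu3, mul_div_mul_left _ _ hY.ne']
  rw [← pow_mul, mul_comm ℓ 6, mul_pow, h6, div_pow, mul_pow,
    show (p : ℝ) ^ (4 * ℓ) = p ^ (2 * ℓ) * p ^ (2 * ℓ) by rw [← pow_add]; congr 1; ring]
  field_simp

lemma le_exp_one_mul_of_floor_log_eq {r s : ℝ} (hr : 0 < r) (hs : 0 < s) (hs1 : s ≤ 1)
    (h : ⌊-Real.log r⌋₊ = ⌊-Real.log s⌋₊) : s ≤ Real.exp 1 * r := by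
  have h1 : (⌊-Real.log s⌋₊ : ℝ) ≤ -Real.log s :=
    Nat.floor_le (neg_nonneg.mpr (Real.log_nonpos hs.le hs1))
  have h2 := Nat.lt_floor_add_one (-Real.log r)
  rw [h] at h2
  rw [← Real.log_le_log_iff hs (by positivity), Real.log_mul (Real.exp_ne_zero 1) hr.ne',
    Real.log_exp]
  linarith

/-- The number of pairs of an `ℓ`-torsion class and a prime of `T` is bounded by the number of
ideals of norm at most `Y`, up to powers of `log Y`: a pair is determined by the ideal `B` of
`exists_span_eq_mul_mul` and the position of its generator at the infinite places, rounded to unit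
boxes on a logarithmic scale. -/
theorem torsionClassNumber_mul_card_le (hK : finrank ℚ K = 3) {ℓ : ℕ} (hℓ : ℓ.Prime)
    (T : Finset ℕ) (hT : ∀ p ∈ T, p.Prime) (hTP : ∀ p ∈ T, ∃ P : Ideal (𝓞 K), Ideal.absNorm P = p)
    (hTD : ∀ p ∈ T, ∀ q ∈ T, p ≠ q → ¬ (p : ℤ) ∣ discr K ∧
      36 * Real.exp 1 ^ (6 * ℓ) * ((p : ℝ) * q) ^ (2 * ℓ) < |(discr K : ℝ)|)
    {Y : ℝ} (hY : Y = 9 * √|(discr K : ℝ)|) :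
    (torsionClassNumber ℓ K : ℝ) * T.card ≤ Y * (1 + Real.log Y) ^ 5 := by
  classical
  have hY1 : 1 ≤ Y := by
    have h1 : (1 : ℝ) ≤ |(discr K : ℝ)| := by
      exact_mod_cast Int.one_le_abs (discr_ne_zero K)
    have h2 : 1 ≤ √|(discr K : ℝ)| := Real.one_le_sqrt.mpr h1
    rw [hY]
    linarith
  have hY0 : 0 < Y := by linarith
  have hlogY : 0 ≤ Real.log Y := Real.log_nonneg hY1
  choose! P hP using hTP
  have hcl (c : classGroupTorsion ℓ K) := exists_ideal_of_mem_classGroupTorsion c.2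
  choose I α hIc hα hIα using hcl
  have hred (x : classGroupTorsion ℓ K × T) := exists_span_eq_mul_mul hK hℓ.ne_zero
    (hT _ x.2.2).ne_zero (hα x.1) (hIα x.1) (hP _ x.2.2) hY
  choose γ B hγ0 hγB hB0 hBY r hr hrY hr1 using hred
  have hr0 (x v) : 0 < r x v := (inv_pos.mpr hY0).trans_le (hrY x v)
  set N := ⌊Y⌋₊ with hN
  set k := ⌊Real.log Y⌋₊ + 1 with hk
  let S : Set (Ideal (𝓞 K)) := {B | B ≠ ⊥ ∧ Ideal.absNorm B ≤ N}
  have hSfin : S.Finite := (Ideal.finite_setOfPred_absNorm_le N).subset fun B hB ↦ hB.2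
  have := hSfin.to_subtype
  have hlogr (x v) : -Real.log (r x v) ≤ Real.log Y := by
    rw [neg_le, ← Real.log_inv]
    exact Real.log_le_log (inv_pos.mpr hY0) (hrY x v)
  let Φ : classGroupTorsion ℓ K × T → S × (InfinitePlace K → Fin k) := fun x ↦
    (⟨B x, hB0 x, Nat.le_floor (hBY x)⟩, fun v ↦ ⟨⌊-Real.log (r x v)⌋₊,
      Nat.lt_succ_of_le (Nat.floor_le_floor (hlogr x v))⟩)
  have hΦ : Function.Injective Φ := by
    rintro ⟨c, p⟩ ⟨c', q⟩ h
    have hB : B (c, p) = B (c', q) := congrArg (fun y ↦ (y.1 : Ideal (𝓞 K))) h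
    have hv (v : InfinitePlace K) :
        ⌊-Real.log (r (c, p) v)⌋₊ = ⌊-Real.log (r (c', q) v)⌋₊ :=
      congrArg (fun y ↦ (y.2 v : ℕ)) h
    have hpq : p = q := by
      by_contra hne
      have hne' : (p : ℕ) ≠ q := fun h ↦ hne (Subtype.ext h)
      obtain ⟨hpD, hlt⟩ := hTD p p.2 q q.2 hne'
      refine absurd (abs_discr_le_of_collision hK hℓ (hT p p.2) (hT q q.2) hne' hpD (hP p p.2)
        (hP q q.2) (hα c') (hIα c) (hIα c') (hγ0 (c, p)) (hγB (c, p))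
        (hB ▸ hγB (c', q)) hY0 fun v ↦ ⟨r (c, p) v, r (c', q) v, hr (c, p) v, hr (c', q) v,
          (hr0 _ _).le, le_exp_one_mul_of_floor_log_eq (hr0 _ _) (hr0 _ _) (hr1 _ _) (hv v)⟩)
        (not_le.mpr hlt)
    subst hpq
    have hcc : c = c' := by
      rw [Subtype.ext_iff, ← hIc c, ← hIc c', ClassGroup.mk0_eq_mk0_iff]
      refine ⟨γ (c', p), γ (c, p), hγ0 _, hγ0 _, ?_⟩
      rw [hγB (c, p), hγB (c', p), hB]
      ring
    rw [hcc]
  have hcard := Nat.card_le_card_of_injective Φ hΦ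
  rw [Nat.card_prod, Nat.card_prod, Nat.card_fun, Nat.card_eq_fintype_card (α := Fin k),
    Fintype.card_fin, Nat.card_coe_set_eq, Nat.card_eq_fintype_card (α := T), Fintype.card_coe,
    Nat.card_eq_fintype_card (α := InfinitePlace K)] at hcard
  have h1 : (torsionClassNumber ℓ K * T.card : ℝ) ≤
      S.ncard * (k : ℝ) ^ Fintype.card (InfinitePlace K) := by exact_mod_cast hcard
  have hNY : (N : ℝ) ≤ Y := Nat.floor_le hY0.le
  have hN1 : (1 : ℝ) ≤ N := by exact_mod_cast Nat.le_floor (by exact_mod_cast hY1)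
  have h2 : (S.ncard : ℝ) ≤ Y * (1 + Real.log Y) ^ 2 := by
    refine (ncard_ideals_norm_le hK N).trans ?_
    have := Real.log_nonneg hN1
    gcongr
  have h3 : (k : ℝ) ^ Fintype.card (InfinitePlace K) ≤ (1 + Real.log Y) ^ 3 := by
    have hk1 : (1 : ℝ) ≤ k := by
      rw [hk]
      push_cast
      linarith [Nat.cast_nonneg (α := ℝ) ⌊Real.log Y⌋₊]
    have hkY : (k : ℝ) ≤ 1 + Real.log Y := by
      rw [hk]
      push_cast
      linarith [Nat.floor_le hlogY]
    exact (pow_le_pow_right₀ hk1 (card_infinitePlace_le hK)).trans (by gcongr)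
  calc _ ≤ _ := h1
    _ ≤ Y * (1 + Real.log Y) ^ 2 * (1 + Real.log Y) ^ 3 := by gcongr
    _ = _ := by ring

end Pigeonhole

/-! ### The bound for pure cubic fields -/

section Assembly

open Filter

lemma card_primeFactors_le_logb {n : ℕ} (hn : n ≠ 0) :
    (n.primeFactors.card : ℝ) ≤ Real.logb 2 n := by
  have h1 : 2 ^ n.primeFactors.card ≤ n := by
    calc 2 ^ n.primeFactors.card = ∏ p ∈ n.primeFactors, 2 := by simp
      _ ≤ ∏ p ∈ n.primeFactors, p :=
        Finset.prod_le_prod' fun p hp ↦ (Nat.prime_of_mem_primeFactors hp).two_le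
      _ ≤ n := Nat.le_of_dvd (Nat.pos_of_ne_zero hn) (Nat.prod_primeFactors_dvd n)
  rw [Real.le_logb_iff_rpow_le (by norm_num) (by positivity), Real.rpow_natCast]
  exact_mod_cast h1

/-- The subtracted logarithm allows for leaving out the prime divisors of the discriminant `x`. -/
lemma eventually_le_card_primesTwoModThree_sub_logb {a M δ : ℝ} (ha : 0 < a) (hM : 0 < M)
    (hδ : 0 < δ) (hδ1 : δ < 1) : ∃ c : ℝ, 0 < c ∧ ∀ᶠ x : ℝ in atTop,
      c * x ^ (a * (1 - δ)) ≤
        (primesTwoModThree ⌊(x / M) ^ a⌋₊).card - Real.logb 2 x := by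
  have hb : 0 < a * (1 - δ) := mul_pos ha (by linarith)
  set c : ℝ := (2⁻¹ * (M ^ a)⁻¹) ^ (1 - δ) with hc
  have hc0 : 0 < c := by positivity
  refine ⟨c / 2, by positivity, ?_⟩
  have hlim : Tendsto (fun x : ℝ ↦ (x / M) ^ a) atTop atTop :=
    (tendsto_rpow_atTop ha).comp (tendsto_id.atTop_div_const hM)
  have e1 := (tendsto_nat_floor_atTop.comp hlim).eventually
    (eventually_le_card_primesTwoModThree hδ)
  have l2 : 0 < Real.log 2 := Real.log_pos (by norm_num)
  have e2 := (isLittleO_log_rpow_atTop hb).bound (show 0 < c / 2 * Real.log 2 by positivity)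
  filter_upwards [e1, e2, hlim.eventually_ge_atTop 1, eventually_ge_atTop 1] with x h1 h2 h3 h4
  have hx0 : 0 < x := by linarith
  rw [Real.norm_of_nonneg (Real.log_nonneg h4), Real.norm_of_nonneg (by positivity)] at h2
  have h5 : Real.logb 2 x ≤ c / 2 * x ^ (a * (1 - δ)) := by
    rw [Real.logb, div_le_iff₀ l2]
    linarith
  have h6 : (x / M) ^ a / 2 ≤ ⌊(x / M) ^ a⌋₊ := by
    have g1 := Nat.lt_floor_add_one ((x / M) ^ a)
    have g2 : (1 : ℝ) ≤ ⌊(x / M) ^ a⌋₊ := by exact_mod_cast Nat.le_floor (by exact_mod_cast h3)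
    linarith
  have h7 : c * x ^ (a * (1 - δ)) = ((x / M) ^ a / 2) ^ (1 - δ) := by
    rw [hc, Real.rpow_mul hx0.le, ← Real.mul_rpow (by positivity) (by positivity),
      Real.div_rpow hx0.le hM.le]
    congr 1
    field_simp
  have h8 : ((x / M) ^ a / 2) ^ (1 - δ) ≤ (primesTwoModThree ⌊(x / M) ^ a⌋₊).card :=
    (Real.rpow_le_rpow (by positivity) h6 (by linarith)).trans h1
  linarith

lemma mul_one_add_log_pow_le {ε : ℝ} (hε : 0 < ε) : ∃ C : ℝ, 0 < C ∧ ∀ x : ℝ, 1 ≤ x →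
    9 * √x * (1 + Real.log (9 * √x)) ^ 5 ≤ C * x ^ (1 / 2 + ε) := by
  refine ⟨(1 + (2 * ε / 5)⁻¹) ^ 5 * 9 ^ (1 + 2 * ε), by positivity, fun x hx ↦ ?_⟩
  have hx0 : 0 < x := by linarith
  have hs : 1 ≤ √x := Real.one_le_sqrt.mpr hx
  set y := 9 * √x with hy
  have hy1 : 1 ≤ y := by linarith
  have hy0 : 0 < y := by linarith
  have h1 : Real.log y ≤ y ^ (2 * ε / 5) / (2 * ε / 5) :=
    Real.log_le_rpow_div hy0.le (by positivity)
  have h2 : 1 ≤ y ^ (2 * ε / 5) := Real.one_le_rpow hy1 (by positivity)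
  have h3 : 1 + Real.log y ≤ (1 + (2 * ε / 5)⁻¹) * y ^ (2 * ε / 5) := by
    rw [div_eq_inv_mul] at h1
    linarith
  have h4 : 0 ≤ Real.log y := Real.log_nonneg hy1
  calc y * (1 + Real.log y) ^ 5 ≤ y * ((1 + (2 * ε / 5)⁻¹) * y ^ (2 * ε / 5)) ^ 5 := by gcongr
    _ = (1 + (2 * ε / 5)⁻¹) ^ 5 * (y * (y ^ (2 * ε / 5)) ^ 5) := by ring
    _ = (1 + (2 * ε / 5)⁻¹) ^ 5 * y ^ (1 + 2 * ε) := by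
      rw [← Real.rpow_natCast (y ^ _), ← Real.rpow_mul hy0.le, Real.rpow_add hy0, Real.rpow_one]
      congr 3
      push_cast
      ring
    _ = _ := by
      rw [hy, Real.mul_rpow (by norm_num) (by positivity), Real.sqrt_eq_rpow,
        ← Real.rpow_mul hx0.le, mul_assoc]
      congr 3
      ring

/-- Up to a constant, the set of all primes `p ≡ 2 mod 3` with `p ^ (4ℓ)` at most a small multiple
of the discriminant `x` may be used in `torsionClassNumber_mul_card_le`. For bounded `x` this set
can be empty, and the single prime `2` serves instead. -/
lemma exists_finset_primes {ℓ : ℕ} (hℓ : ℓ ≠ 0) {ε : ℝ} (hε : 0 < ε)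
    (hεℓ : ε < 1 / (4 * (ℓ : ℝ))) : ∃ c : ℝ, 0 < c ∧ ∀ D : ℤ, D ≠ 0 →
      ∃ T : Finset ℕ, (∀ p ∈ T, p.Prime ∧ p % 3 = 2) ∧
        (∀ p ∈ T, ∀ q ∈ T, p ≠ q → ¬ (p : ℤ) ∣ D ∧
          36 * Real.exp 1 ^ (6 * ℓ) * ((p : ℝ) * q) ^ (2 * ℓ) < |(D : ℝ)|) ∧
        c * |(D : ℝ)| ^ (1 / (4 * (ℓ : ℝ)) - ε) ≤ T.card := by
  have hℓ0 : (0 : ℝ) < ℓ := by positivity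
  set a : ℝ := 1 / (4 * (ℓ : ℝ)) with ha
  have ha0 : 0 < a := by positivity
  set E : ℝ := 36 * Real.exp 1 ^ (6 * ℓ) with hE
  have hE0 : 0 < E := by positivity
  obtain ⟨c, hc, hev⟩ := eventually_le_card_primesTwoModThree_sub_logb (δ := ε / a) ha0
    (show 0 < E + 1 by positivity) (by positivity) ((div_lt_one ha0).mpr hεℓ)
  have hexp : a * (1 - ε / a) = a - ε := by field_simp
  rw [hexp] at hev
  obtain ⟨x₀, hx₀⟩ := eventually_atTop.mp hev
  set x₁ := max x₀ 1 with hx₁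
  have hx₁1 : 1 ≤ x₁ := le_max_right _ _
  refine ⟨min c (x₁ ^ (a - ε))⁻¹, by positivity, fun D hD ↦ ?_⟩
  have hD1 : (1 : ℝ) ≤ |(D : ℝ)| := by exact_mod_cast Int.one_le_abs hD
  set x := |(D : ℝ)| with hx
  have hx0 : 0 < x := by linarith
  rcases le_total x₁ x with h | h
  · refine ⟨(primesTwoModThree ⌊(x / (E + 1)) ^ a⌋₊).filter fun p : ℕ ↦ ¬ (p : ℤ) ∣ D, ?_, ?_, ?_⟩
    · intro p hp
      simp only [primesTwoModThree, Finset.mem_filter] at hp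
      exact hp.1.2
    · intro p hp q hq _
      have hbound (p : ℕ) (hp : p ∈ primesTwoModThree ⌊(x / (E + 1)) ^ a⌋₊) :
          (p : ℝ) ≤ (x / (E + 1)) ^ a := by
        simp only [primesTwoModThree, Finset.mem_filter, Finset.mem_Ioc] at hp
        exact (Nat.le_floor_iff (by positivity)).mp hp.1.2
      rw [Finset.mem_filter] at hp hq
      refine ⟨hp.2, ?_⟩
      have h1 : ((p : ℝ) * q) ^ (2 * ℓ) ≤ x / (E + 1) := by
        calc ((p : ℝ) * q) ^ (2 * ℓ)
            ≤ ((x / (E + 1)) ^ a * (x / (E + 1)) ^ a) ^ (2 * ℓ) := by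
              gcongr
              exacts [hbound p hp.1, hbound q hq.1]
          _ = x / (E + 1) := by
              rw [← Real.rpow_add (by positivity), ← Real.rpow_natCast,
                ← Real.rpow_mul (by positivity)]
              have : (a + a) * ((2 * ℓ : ℕ) : ℝ) = 1 := by
                rw [ha]
                push_cast
                field_simp
                norm_num
              rw [this, Real.rpow_one]
      calc E * ((p : ℝ) * q) ^ (2 * ℓ) ≤ E * (x / (E + 1)) := by gcongr
        _ < x := by
          rw [mul_div_assoc', div_lt_iff₀ (by positivity)]
          linarith
    · have h1 := hx₀ x ((le_max_left _ _).trans h)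
      have h2 : ((primesTwoModThree ⌊(x / (E + 1)) ^ a⌋₊).card : ℝ) ≤
          ((primesTwoModThree ⌊(x / (E + 1)) ^ a⌋₊).filter fun p : ℕ ↦ ¬ (p : ℤ) ∣ D).card +
            Real.logb 2 x := by
        have h3 := card_primeFactors_le_logb (Int.natAbs_ne_zero.mpr hD)
        rw [Nat.cast_natAbs, Int.cast_abs] at h3
        have h4 : ((primesTwoModThree ⌊(x / (E + 1)) ^ a⌋₊).filter
            fun p : ℕ ↦ (p : ℤ) ∣ D).card ≤ D.natAbs.primeFactors.card := by
          refine Finset.card_le_card fun p hp ↦ ?_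
          simp only [primesTwoModThree, Finset.mem_filter] at hp
          rw [Nat.mem_primeFactors]
          exact ⟨hp.1.2.1, Int.natCast_dvd.mp hp.2, Int.natAbs_ne_zero.mpr hD⟩
        have h4' := (Nat.cast_le (α := ℝ)).mpr h4
        rw [← Finset.card_filter_add_card_filter_not
          (s := primesTwoModThree ⌊(x / (E + 1)) ^ a⌋₊) (fun p : ℕ ↦ (p : ℤ) ∣ D)]
        push_cast
        linarith
      calc min c (x₁ ^ (a - ε))⁻¹ * x ^ (a - ε) ≤ c * x ^ (a - ε) := by
            gcongr
            exact min_le_left _ _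
        _ ≤ _ := by linarith
  · refine ⟨{2}, ?_, ?_, ?_⟩
    · intro p hp
      rw [Finset.mem_singleton] at hp
      subst hp
      exact ⟨Nat.prime_two, rfl⟩
    · intro p hp q hq hne
      rw [Finset.mem_singleton] at hp hq
      exact absurd (hp.trans hq.symm) hne
    · calc min c (x₁ ^ (a - ε))⁻¹ * x ^ (a - ε)
          ≤ (x₁ ^ (a - ε))⁻¹ * x₁ ^ (a - ε) := by
            gcongr
            exact min_le_right _ _
        _ = 1 := inv_mul_cancel₀ (by positivity)
        _ = _ := by simp

end Assembly

theorem mainTheorem6 (ℓ : ℕ) (hℓ : ℓ.Prime) (ε : ℝ) (hε : 0 < ε) :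
    ∃ C : ℝ, 0 < C ∧ ∀ (K : Type*) [Field K] [NumberField K], IsPureCubicField K →
      (torsionClassNumber ℓ K : ℝ) ≤
        C * |(NumberField.discr K : ℝ)| ^ ((1 : ℝ) / 2 - 1 / (4 * (ℓ : ℝ)) + ε) := by
  have hℓ0 : (0 : ℝ) < ℓ := by exact_mod_cast hℓ.pos
  set a : ℝ := 1 / (4 * (ℓ : ℝ)) with ha
  have ha0 : 0 < a := by positivity
  -- Half of the allowed `ε` pays for the logarithms, half for the shortage of primes.
  obtain ⟨η, hη0, hηε, hηa⟩ : ∃ η : ℝ, 0 < η ∧ 2 * η ≤ ε ∧ η < a := by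
    refine ⟨min (ε / 2) (a / 2), by positivity, ?_, ?_⟩
    · linarith [min_le_left (ε / 2) (a / 2)]
    · linarith [min_le_right (ε / 2) (a / 2)]
  obtain ⟨C, hC, hCx⟩ := mul_one_add_log_pow_le hη0
  obtain ⟨c, hc, hcT⟩ := exists_finset_primes hℓ.ne_zero hη0 hηa
  refine ⟨C / c, by positivity, fun K _ _ hK ↦ ?_⟩
  obtain ⟨T, hT, hTD, hTc⟩ := hcT (discr K) (discr_ne_zero K)
  have h1 := torsionClassNumber_mul_card_le hK.finrank_eq_three hℓ T (fun p hp ↦ (hT p hp).1)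
    (fun p hp ↦ hK.exists_absNorm_eq (hT p hp).1 (hT p hp).2) hTD rfl
  have hx1 : (1 : ℝ) ≤ |(discr K : ℝ)| := by exact_mod_cast Int.one_le_abs (discr_ne_zero K)
  have h2 := hCx _ hx1
  set x := |(discr K : ℝ)| with hx
  have hx0 : 0 < x := by linarith
  have h3 : (torsionClassNumber ℓ K : ℝ) * (c * x ^ (a - η)) ≤ C * x ^ (1 / 2 + η) :=
    (mul_le_mul_of_nonneg_left hTc (Nat.cast_nonneg _)).trans (h1.trans h2)
  rw [← mul_assoc, mul_comm (torsionClassNumber ℓ K : ℝ) c] at h3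
  calc (torsionClassNumber ℓ K : ℝ)
      = c * torsionClassNumber ℓ K * x ^ (a - η) / (c * x ^ (a - η)) := by field_simp
    _ ≤ C * x ^ (1 / 2 + η) / (c * x ^ (a - η)) := by gcongr
    _ = C / c * x ^ (1 / 2 + η - (a - η)) := by
        rw [Real.rpow_sub hx0 _ (a - η), mul_div_mul_comm]
    _ ≤ C / c * x ^ (1 / 2 - a + ε) := by
        gcongr
        linarith
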